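/- Let $v_1,\dots,v_K,v_0\in\mathbb R^d$ and $w_1,\dots,w_L\in\mathbb R$ be known. In each round $t=1,\dots,T$ a learner plays a list $a_t=(a_t^1,\dots,a_t^L)\in\{1,\dots,K\}^L$ (repetitions allowed) and observes, for each position $l$, the reward $$r_t^l=\langle\theta^l,x_{a_t}^l\rangle+\eta_t^l,\qquad x_a^l=v_{a^l}+w_l v_{a^{l-1}},\quad v_{a^0}:=v_0 .$$ The unknown parameters $\theta^1,\dots,\theta^L\in\mathbb R^d$ are random and independent, $\theta^l$ having prior law $\mathcal Q^l$. The noise variables $\eta_t^l$ are independent, centered and $1$-subgaussian ($\mathbb E e^{s\eta_t^l}\le e^{s^2/2}$ for all $s\in\mathbb{R}$), and $(\eta_t^l)_{l\le L}$ is independent of the parameters, of the history $\mathcal H_t=(a_s,(r_s^l)_{l\le L})_{s<t}$ and of the learner's sample $\hat\theta_t$ described next. RankTS: in round $t$, given $\mathcal H_t$ and independently of $\theta=(\theta^1,\dots,\theta^L)$ given $\mathcal H_t$, the learner draws $\hat\theta_t=(\hat\theta_t^1,\dots,\hat\theta_t^L)$ from $\mathcal Q^1(\cdot\mid\mathcal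 H_t)\otimes\dots\otimes\mathcal Q^L(\cdot\mid\mathcal H_t)$, where $\mathcal Q^l(\cdot\mid\mathcal H_t)$ is the posterior distribution of $\theta^l$ given $\mathcal H_t$. It then plays the list of items along a longest path with $L$ vertices, found by a fixed measurable path algorithm, in the following layered graph. The vertices of layer $1$ are the pairs $(0,i)$, those of each layer $l\ge2$ are the pairs $(i,j)$, with $1\le i,j\le K$. Edges go from $(i,j)$ in layer $l$ to every $(j,q)$ in layer $l+1$, with weight $$\tfrac12\big(\epsilon_l\langle\hat\theta_t^l,v_j+w_lv_i\rangle+\epsilon'_{l+1}\langle\hat\theta_t^{l+1},v_q+w_{l+1}v_j\rangle\big),$$ where $\epsilon_1=2$ and $\epsilon_l=1$ for $l>1$, and $\epsilon'_L=2$ and $\epsilon'_l=1$ for $l<L$. (For $L=1$, where there are no edges, the weight of the one-vertex path $(0,j)$ is $\langle\hat\theta_t^1,v_j+w_1v_0\rangle$.) Suppose that for some $m_1,m_2>0$: (a) $\|v_i\|_2\le m_1$ for $i=1,\dots,K$, and $\|v_0\|_2\le m_1$ or $w_1=0$; (b) $\|\theta^l\|_2\le m_2$ with $\mathcal Q^l$-probability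 one, for every $l$; (c) for every $l$, with $\mathcal Q^l$-probability one, $|\langle\theta^l,x\rangle|\le1$ for all super-arm features $x$ of position $l$ (that is, $x=v_j+w_1v_0$ if $l=1$ and $x=v_j+w_lv_i$ if $l\ge2$, with $1\le i,j\le K$). Put $\lambda=1/m_2^2$. Then the Bayesian expected regret $$\mathcal R_T=\mathbb E\Big[\sum_{t=1}^T\max_{a\in\{1,\dots,K\}^L}\sum_{l=1}^L\langle\theta^l,x_a^l\rangle-\sum_{t=1}^T\sum_{l=1}^L r_t^l\Big]$$ is well defined (the variable is integrable) and $$\mathcal R_T\le 2L\left(1+\sqrt{2Td\,\beta^2\log\Big(1+\tfrac{T\left((1+\max_{l}|w_l|)m_1\right)^2}{d\lambda}\Big)}\right),\qquad \beta=1+\sqrt{4\log T+d\log\Big(1+\tfrac{T\left((1+\max_{l}|w_l|)m_1\right)^2}{d\lambda}\Big)} .$$ -/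

import Mathlib

open MeasureTheory ProbabilityTheory

noncomputable section

namespace RankBandit

/-- The known data of a linear ranking problem with `K` arms, `L` positions and features in
`ℝ^d`: the arm vectors `v i`, the vector `v₀` standing for the item before the first position, and
the weights `w l` of the dependency on the previous item.
Positions are `0, …, L - 1`, so position `l` here is position `l + 1` in the usual counting. -/
structure Model (d L K : ℕ) where
  v : Fin K → EuclideanSpace ℝ (Fin d)
  v₀ : EuclideanSpace ℝ (Fin d)
  w : Fin L → ℝ

/-- A list of `L` arms; repetitions are allowed. -/
abbrev Action (L K : ℕ) : Type := Fin L → Fin K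

/-- A parameter vector `(θ^1, …, θ^L)`. -/
abbrev Params (d L : ℕ) : Type := Fin L → EuclideanSpace ℝ (Fin d)

/-- The feature `v_j + w_l v_i` of the super-arm `(i, j)` at position `l`; the previous item `none`
means that there is no previous item, and then `v_i` is `v₀`. -/
def Model.feature {d L K : ℕ} (M : Model d L K) (l : Fin L) (i : Option (Fin K)) (j : Fin K) :
    EuclideanSpace ℝ (Fin d) :=
  M.v j + M.w l • i.elim M.v₀ M.v

/-- The item that precedes position `l` in the list `a`. -/
def prevItem {L K : ℕ} (a : Action L K) (l : Fin L) : Option (Fin K) :=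
  if l.val = 0 then none else some (a ⟨l.val - 1, lt_of_le_of_lt (Nat.sub_le _ _) l.isLt⟩)

/-- The feature `v_{a^l} + w_l v_{a^{l-1}}` of position `l` of the list `a`. -/
def Model.actionFeature {d L K : ℕ} (M : Model d L K) (a : Action L K) (l : Fin L) :
    EuclideanSpace ℝ (Fin d) :=
  M.feature l (prevItem a l) (a l)

/-- `∑_l E[r_a^l]` under the parameter `ϑ`. -/
def Model.meanReward {d L K : ℕ} (M : Model d L K) (ϑ : Params d L) (a : Action L K) : ℝ :=
  ∑ l, inner ℝ (ϑ l) (M.actionFeature a l)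

/-! ### The `L`-layered graph over super-arms -/

/-- A vertex of the `L`-layered graph: a super-arm `(prev, cur)` placed in a layer. In the first
layer, and only there, there is no previous item. -/
structure Node (L K : ℕ) where
  layer : Fin L
  prev : Option (Fin K)
  cur : Fin K
  prev_eq_none_iff : prev = none ↔ layer.val = 0

/-- The edges go from `(i, j)` in a layer to every `(j, q)` in the next layer. -/
def layeredGraph (L K : ℕ) : Digraph (Node L K) where
  Adj u u' := u'.layer.val = u.layer.val + 1 ∧ u'.prev = some u.cur

/-- Expected reward of a super-arm under the parameter `ϑ`. -/
def Model.nodeReward {d L K : ℕ} (M : Model d L K) (ϑ : Params d L) (u : Node L K) : ℝ :=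
  inner ℝ (ϑ u.layer) (M.feature u.layer u.prev u.cur)

/-- Weight of the edge from `u` to `u'`: half the sum of the rewards of its two ends, where a first
layer tail and a last layer head count twice. -/
def Model.edgeWeight {d L K : ℕ} (M : Model d L K) (ϑ : Params d L) (u u' : Node L K) : ℝ :=
  (1 / 2) * ((if u.layer.val = 0 then 2 else 1) * M.nodeReward ϑ u +
    (if u'.layer.val + 1 = L then 2 else 1) * M.nodeReward ϑ u')

/-- `p` is a path with `L` vertices in the layered graph. -/
def IsPath {L K : ℕ} (p : Fin L → Node L K) : Prop :=
  ∀ (l : Fin L) (h : l.val + 1 < L), (layeredGraph L K).Adj (p l) (p ⟨l.val + 1, h⟩)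

/-- Weight of a path: the sum of the weights of its edges. In the degenerate case `L = 1`, where
there are no edges, it is the reward of the only vertex of the path. -/
def Model.pathWeight {d L K : ℕ} (M : Model d L K) (ϑ : Params d L) (p : Fin L → Node L K) : ℝ :=
  if L = 1 then ∑ l, M.nodeReward ϑ (p l)
  else ∑ l : Fin L, if h : l.val + 1 < L then M.edgeWeight ϑ (p l) (p ⟨l.val + 1, h⟩) else 0

/-- `p` is a longest path with `L` vertices, for the edge weights given by `ϑ`. -/
def Model.IsLongestPath {d L K : ℕ} (M : Model d L K) (ϑ : Params d L) (p : Fin L → Node L K) :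
    Prop :=
  IsPath p ∧ ∀ q : Fin L → Node L K, IsPath q → M.pathWeight ϑ q ≤ M.pathWeight ϑ p

/-- The list of items along a path. -/
def pathAction {L K : ℕ} (p : Fin L → Node L K) : Action L K := fun l => (p l).cur

/-! ### The algorithm and its regret -/

/-- The history before round `t`: all lists played and all rewards observed in earlier rounds.
Rounds are `0, 1, …, T - 1`. -/
def history {Ω : Type*} {L K : ℕ} (a : ℕ → Ω → Action L K) (r : ℕ → Fin L → Ω → ℝ) (t : ℕ)
    (ω : Ω) : Fin t → Action L K × (Fin L → ℝ) :=
  fun s => (a s ω, fun l => r s l ω)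

/-- A run, over `T` rounds, of ranking Thompson sampling with priors `Q l` against linear rewards,
on the probability space `(Ω, P)`. -/
structure RankTSRun {Ω : Type*} [MeasurableSpace Ω] {d L K : ℕ} (M : Model d L K)
    (Q : Fin L → Measure (EuclideanSpace ℝ (Fin d))) (T : ℕ) (P : Measure Ω)
    [IsProbabilityMeasure P] where
  /-- the true parameters -/
  θ : Ω → Params d L
  /-- the noise in round `t` at position `l` -/
  η : ℕ → Fin L → Ω → ℝ
  /-- the parameters sampled by the algorithm in round `t` -/
  θhat : ℕ → Ω → Params d L
  /-- the list played in round `t` -/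
  a : ℕ → Ω → Action L K
  /-- the reward observed in round `t` at position `l` -/
  r : ℕ → Fin L → Ω → ℝ
  /-- the path algorithm, for the graph weighted by a parameter vector -/
  solver : Params d L → (Fin L → Node L K)
  measurable_θ : Measurable θ
  measurable_η : ∀ t < T, ∀ l, Measurable (η t l)
  measurable_θhat : ∀ t < T, Measurable (θhat t)
  /-- the `θ^l` are independent with laws `Q l` -/
  law_θ : P.map θ = Measure.pi Q
  /-- the noise variables are independent -/
  noise_indep : iIndepFun (fun (p : Fin T × Fin L) => η p.1.val p.2) P
  /-- the noise is `1`-subgaussian: `E exp (s η) ≤ exp (s² / 2)` for all `s`; in particular it is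
  centered -/
  noise_subgaussian : ∀ t < T, ∀ l, HasSubgaussianMGF (η t l) 1 P
  /-- the noise of a round is independent of the parameters, of the past, and of the parameters
  sampled in that round -/
  noise_fresh : ∀ t < T,
    IndepFun (fun ω l => η t l ω) (fun ω => (θ ω, history a r t ω, θhat t ω)) P
  /-- linear rewards -/
  reward_eq : ∀ t < T, ∀ l ω,
    r t l ω = inner ℝ (θ ω l) (M.actionFeature (a t ω) l) + η t l ω
  /-- the algorithm samples `θhat t` from the product over `l` of the posterior distributions of
  `θ^l` given the history, with fresh randomness: the conditional law of `θhat t` given the history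
  and the true parameters is that product -/
  sample_law : ∀ t < T, ∀ᵐ ω ∂P,
    condDistrib (θhat t) (fun ω' => (θ ω', history a r t ω')) P (θ ω, history a r t ω) =
      Measure.pi fun l =>
        condDistrib (fun ω' => θ ω' l) (history a r t) P (history a r t ω)
  /-- the path algorithm finds a longest path -/
  solver_longest : ∀ ϑ, M.IsLongestPath ϑ (solver ϑ)
  measurable_solver : Measurable fun ϑ => pathAction (solver ϑ)
  /-- the list played is the one along a longest path for the sampled parameters -/
  action_eq : ∀ t < T, ∀ ω, a t ω = pathAction (solver (θhat t ω))

/-- `∑_t max_a ∑_l E[r_a^l] - ∑_t ∑_l r_{a_t}^l` on the outcome `ω`, where the inner expectation is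
under the true parameters. -/
def RankTSRun.regretSample {Ω : Type*} [MeasurableSpace Ω] {d L K : ℕ} {M : Model d L K}
    {Q : Fin L → Measure (EuclideanSpace ℝ (Fin d))} {T : ℕ} {P : Measure Ω}
    [IsProbabilityMeasure P] (R : RankTSRun M Q T P) (ω : Ω) : ℝ :=
  ∑ _t ∈ Finset.range T, (⨆ a : Action L K, M.meanReward (R.θ ω) a) -
    ∑ t ∈ Finset.range T, ∑ l, R.r t l ω

/-! ### The bound -/

/-- `log (1 + T ((1 + max_l |w_l|) m₁)² / (d λ))`. -/
def Model.logTerm {d L K : ℕ} (M : Model d L K) (T : ℕ) (m₁ lam : ℝ) : ℝ :=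
  Real.log (1 + T * ((1 + ⨆ l, |M.w l|) * m₁) ^ 2 / (d * lam))

/-- `β = 1 + √(4 log T + d log (1 + T ((1 + max_l |w_l|) m₁)² / (d λ)))`. -/
def Model.beta {d L K : ℕ} (M : Model d L K) (T : ℕ) (m₁ lam : ℝ) : ℝ :=
  1 + √(4 * Real.log T + d * M.logTerm T m₁ lam)

end RankBandit

end

/-! The regret splits into one term per position, and each position is treated as a linear bandit
with its own Gram matrix.

Exchange. The algorithm samples from the product of the marginal posteriors, which is the true joint
posterior only if the `θ^l` are independent given the history. This holds by induction on the round
(`RankTSRun.exists_piKernel`): the played list depends on `θhat`, which given the history carries no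
information on `θ`, and the reward at position `l` involves only `θ^l` and its own fresh noise.
Hence `(H, θ)` and `(H, θhat)` have the same law (`RankTSRun.map_H_θ_eq_map_H_θhat`). In a path each
inner vertex collects half its reward from each of two edges, and the doubled end weights complete
the two ends, so a longest path is an optimal list for the parameters that weight the graph. The
optimal and the played list are thus the same function `best` of `θ` and of `θhat`, and any index
computed from the history has the same mean at both (`RankTSRun.integral_ucb_best_eq`).

Concentration. For a clipped upper confidence index `U`, the loss is at most `U(best) - U(played)`,
of mean zero, plus `4` on a bad event, plus `2β √(min 1 ‖x‖²)` with the norm of the inverse Gram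
matrix. Mixing exponential supermartingales over a Gaussian prior bounds the probability of the bad
event by `1 / T²` (`measure_invForm_ge_le`). The widths are summed by Cauchy–Schwarz and the
elliptical potential lemma (`sum_min_one_invForm_le`). The bad events cost `4 / T ≤ 2` in all once
`T ≥ 2`. -/

noncomputable section

namespace RankBandit

open scoped ENNReal

/-! ### Products of Markov kernels as conditional laws. -/

section PiKernel

variable {ι 𝓖 : Type*} [Fintype ι] [MeasurableSpace 𝓖] {X : ι → Type*} [∀ i, MeasurableSpace (X i)]

/-- Two finite measures on `𝓖 × ∏ i, X i` that agree on products of a set and a box are equal. -/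
lemma ext_prod_box {μ ν : Measure (𝓖 × ∀ i, X i)} [IsFiniteMeasure μ]
    (h : ∀ (A : Set 𝓖) (B : ∀ i, Set (X i)), MeasurableSet A → (∀ i, MeasurableSet (B i)) →
      μ (A ×ˢ Set.univ.pi B) = ν (A ×ˢ Set.univ.pi B)) : μ = ν := by
  refine ext_of_generate_finite
    (Set.image2 (· ×ˢ ·) {s : Set 𝓖 | MeasurableSet s}
      (Set.univ.pi '' Set.univ.pi fun i => {s : Set (X i) | MeasurableSet s}))
    (generateFrom_eq_prod MeasurableSpace.generateFrom_measurableSet generateFrom_pi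
      isCountablySpanning_measurableSet
      ⟨fun _ => Set.univ, fun _ => ⟨fun _ => Set.univ, by simp, by simp⟩,
        Set.iUnion_const _⟩).symm
    (MeasurableSpace.isPiSystem_measurableSet.prod isPiSystem_pi) ?_ ?_
  · rintro _ ⟨A, hA, _, ⟨B, hB, rfl⟩, rfl⟩
    exact h A B hA fun i => hB i trivial
  · have := h Set.univ (fun _ => Set.univ) .univ fun _ => .univ
    simpa using this

/-- The product of finitely many Markov kernels with the same source. -/
def piKernel (κ : ∀ i, Kernel 𝓖 (X i)) [∀ i, IsMarkovKernel (κ i)] : Kernel 𝓖 (∀ i, X i) where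
  toFun g := Measure.pi fun i => κ i g
  measurable' := by
    refine Measurable.measure_of_isPiSystem_of_isProbabilityMeasure
      (generateFrom_pi (α := X)).symm isPiSystem_pi ?_
    rintro _ ⟨B, hB, rfl⟩
    simp only [Measure.pi_pi]
    exact Finset.measurable_prod _ fun i _ => (κ i).measurable_coe (hB i trivial)

variable (κ : ∀ i, Kernel 𝓖 (X i)) [∀ i, IsMarkovKernel (κ i)]

lemma piKernel_apply (g : 𝓖) : piKernel κ g = Measure.pi fun i => κ i g := rfl

instance : IsMarkovKernel (piKernel κ) :=
  ⟨fun g => by rw [piKernel_apply]; infer_instance⟩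

/-- `∫ ∏ f_i(x_i) = ∏ ∫ f_i` for product probability measures. -/
lemma lintegral_pi_prod {μ : ∀ i, Measure (X i)} [∀ i, IsProbabilityMeasure (μ i)]
    {f : ∀ i, X i → ℝ≥0∞} (hf : ∀ i, Measurable (f i)) :
    ∫⁻ x, ∏ i, f i (x i) ∂Measure.pi μ = ∏ i, ∫⁻ y, f i y ∂μ i := by
  have hind : iIndepFun (fun i (x : ∀ i, X i) => f i (x i)) (Measure.pi μ) :=
    iIndepFun_pi fun i => (hf i).aemeasurable
  rw [lintegral_prod_eq_prod_lintegral_of_indepFun Finset.univ _ hind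
    fun i => (hf i).comp (measurable_pi_apply i)]
  refine Finset.prod_congr rfl fun i _ => ?_
  rw [← (measurePreserving_eval μ i).lintegral_comp (hf i)]

/-- The marginals of a conditional product law. -/
lemma map_eval_of_compProd_piKernel {Ω : Type*} [MeasurableSpace Ω] {P : Measure Ω}
    [IsProbabilityMeasure P] {G : Ω → 𝓖} (hG : Measurable G) {x : ∀ i, Ω → X i}
    (hx : ∀ i, Measurable (x i))
    (h : P.map (fun ω => (G ω, fun i => x i ω)) = P.map G ⊗ₘ piKernel κ) (i : ι) :
    P.map (fun ω => (G ω, x i ω)) = P.map G ⊗ₘ κ i := by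
  classical
  have := Measure.isProbabilityMeasure_map (μ := P) hG.aemeasurable
  have hm : P.map (fun ω => (G ω, x i ω)) =
      (P.map (fun ω => (G ω, fun i => x i ω))).map (fun p => (p.1, p.2 i)) := by
    rw [Measure.map_map (by fun_prop) (by fun_prop)]
    rfl
  rw [hm, h]
  refine Measure.ext_prod (fun {s t} hs ht => ?_)
  rw [Measure.map_apply (by fun_prop) (hs.prod ht), Measure.compProd_apply_prod hs ht]
  have : (fun p : 𝓖 × (∀ i, X i) => (p.1, p.2 i)) ⁻¹' s ×ˢ t =
      s ×ˢ (Function.eval i ⁻¹' t) := by ext; simp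
  rw [this, Measure.compProd_apply_prod hs (measurable_pi_apply i ht)]
  refine lintegral_congr fun g => ?_
  rw [piKernel_apply, (measurePreserving_eval (fun i => κ i g) i).measure_preimage
    ht.nullMeasurableSet]

end PiKernel

/-! ### Conditioning independent pairs on their first components. -/

section Disintegration

variable {ι 𝓖 E : Type*} [Fintype ι] [MeasurableSpace 𝓖] [MeasurableSpace E]
  [StandardBorelSpace E] [Nonempty E]

/-- If the pairs `(x_i, y_i)` are independent given `G`, then the `x_i` are independent given `G`
and all the `y_i`. -/
lemma exists_piKernel_of_pairs {Ω : Type*} [MeasurableSpace Ω] {P : Measure Ω}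
    [IsProbabilityMeasure P] {G : Ω → 𝓖} (hG : Measurable G) {x : Ω → ι → E} (hx : Measurable x)
    {y : Ω → ι → ℝ} (hy : Measurable y)
    (κ : ι → Kernel 𝓖 (ℝ × E)) [∀ i, IsMarkovKernel (κ i)]
    (h : P.map (fun ω => (G ω, fun i => (y ω i, x ω i))) = P.map G ⊗ₘ piKernel κ) :
    ∃ (ρ : ι → Kernel (𝓖 × (ι → ℝ)) E) (_ : ∀ i, IsMarkovKernel (ρ i)),
      P.map (fun ω => ((G ω, y ω), x ω)) = P.map (fun ω => (G ω, y ω)) ⊗ₘ piKernel ρ := by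
  have := Measure.isProbabilityMeasure_map (μ := P) hG.aemeasurable
  -- The posterior of `x_i` sees only `y_i`: the other pairs carry no information about it.
  let ρ : ι → Kernel (𝓖 × (ι → ℝ)) E := fun i =>
    (Kernel.condKernel (κ i)).comap (fun p : 𝓖 × (ι → ℝ) => (p.1, p.2 i)) (by fun_prop)
  have hρ : ∀ i, IsMarkovKernel (ρ i) := fun i => Kernel.IsMarkovKernel.comap _ _
  refine ⟨ρ, hρ, ?_⟩
  have hsnd : P.map (fun ω => (G ω, y ω)) = P.map G ⊗ₘ piKernel fun i => (κ i).fst := by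
    refine ext_prod_box fun A C hA hC => ?_
    have hm : MeasurableSet (Set.univ.pi C) := MeasurableSet.univ_pi hC
    have hm' : MeasurableSet (Set.univ.pi fun i => Prod.fst ⁻¹' C i : Set (ι → ℝ × E)) :=
      MeasurableSet.univ_pi fun i => measurable_fst (hC i)
    have h1 := congrArg (fun μ => μ (A ×ˢ Set.univ.pi fun i => Prod.fst ⁻¹' C i)) h
    beta_reduce at h1
    rw [Measure.map_apply (by fun_prop) (hA.prod hm'), Measure.compProd_apply_prod hA hm'] at h1
    rw [Measure.map_apply (by fun_prop) (hA.prod hm), Measure.compProd_apply_prod hA hm]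
    simp only [piKernel_apply, Measure.pi_pi] at h1 ⊢
    simp only [Kernel.fst_apply' _ _ (hC _)]
    exact h1
  let zip : (𝓖 × (ι → ℝ)) × (ι → E) → 𝓖 × (ι → ℝ × E) :=
    fun q => (q.1.1, fun i => (q.1.2 i, q.2 i))
  let unzip : 𝓖 × (ι → ℝ × E) → (𝓖 × (ι → ℝ)) × (ι → E) :=
    fun q => ((q.1, fun i => (q.2 i).1), fun i => (q.2 i).2)
  have hzip : Measurable zip := by fun_prop
  have hunzip : Measurable unzip := by fun_prop
  -- `zip` and `unzip` are mutually inverse rearrangements, so the identity may be tested on boxes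
  -- of pairs, where `h` applies.
  suffices hs : (P.map (fun ω => (G ω, y ω)) ⊗ₘ piKernel ρ).map zip = P.map G ⊗ₘ piKernel κ by
    have h1 : P.map (fun ω => ((G ω, y ω), x ω)) =
        (P.map (fun ω => (G ω, fun i => (y ω i, x ω i)))).map unzip := by
      rw [Measure.map_map hunzip (by fun_prop)]
      rfl
    rw [h1, h, ← hs, Measure.map_map hunzip hzip]
    exact Measure.map_id
  have := Measure.isProbabilityMeasure_map (μ := P) (hG.prodMk hy).aemeasurable
  have := Measure.isProbabilityMeasure_map (μ := P.map (fun ω => (G ω, y ω)) ⊗ₘ piKernel ρ)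
    hzip.aemeasurable
  refine ext_prod_box fun A B hA hB => ?_
  have hm : MeasurableSet (Set.univ.pi B) := MeasurableSet.univ_pi hB
  have hpre : ∀ i, Measurable fun p : (𝓖 × (ι → ℝ)) =>
      ρ i p (Prod.mk (p.2 i) ⁻¹' B i) := fun i =>
    Kernel.measurable_kernel_prodMk_left
      (t := {q : (𝓖 × (ι → ℝ)) × E | (q.1.2 i, q.2) ∈ B i})
      ((by fun_prop : Measurable fun q : (𝓖 × (ι → ℝ)) × E => (q.1.2 i, q.2)) (hB i))
  have hpre' : ∀ i g, Measurable fun t : ℝ =>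
      Kernel.condKernel (κ i) (g, t) (Prod.mk t ⁻¹' B i) := fun i g =>
    (Kernel.measurable_kernel_prodMk_left
      (t := {q : (𝓖 × ℝ) × E | (q.1.2, q.2) ∈ B i})
      ((by fun_prop : Measurable fun q : (𝓖 × ℝ) × E => (q.1.2, q.2)) (hB i))).comp
      (measurable_prodMk_left (x := g))
  rw [Measure.map_apply hzip (hA.prod hm), Measure.compProd_apply (hzip (hA.prod hm)),
    Measure.compProd_apply_prod hA hm]
  have hsec : ∀ p : 𝓖 × (ι → ℝ), piKernel ρ p (Prod.mk p ⁻¹' (zip ⁻¹' A ×ˢ Set.univ.pi B)) =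
      (A ×ˢ Set.univ).indicator (fun p => ∏ i, ρ i p (Prod.mk (p.2 i) ⁻¹' B i)) p := by
    intro p
    by_cases hp : p.1 ∈ A
    · have : Prod.mk p ⁻¹' (zip ⁻¹' A ×ˢ Set.univ.pi B) =
          Set.univ.pi fun i => Prod.mk (p.2 i) ⁻¹' B i := by
        ext q; simp [zip, hp]
      rw [this, piKernel_apply, Measure.pi_pi, Set.indicator_of_mem (by simp [hp])]
    · have : Prod.mk p ⁻¹' (zip ⁻¹' A ×ˢ Set.univ.pi B) = ∅ := by
        ext q; simp [zip, hp]
      rw [this, measure_empty, Set.indicator_of_notMem (by simp [hp])]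
  simp only [hsec]
  rw [lintegral_indicator (hA.prod .univ), hsnd,
    Measure.setLIntegral_compProd (Finset.measurable_prod _ fun i _ => hpre i) hA .univ]
  refine lintegral_congr fun g => ?_
  rw [Measure.restrict_univ, piKernel_apply, piKernel_apply, Measure.pi_pi]
  -- For fixed `g` the integrand is a product over coordinates; the claim becomes the disintegration
  -- of each `κ i`.
  refine (lintegral_pi_prod (hpre' · g)).trans (Finset.prod_congr rfl fun i _ => ?_)
  conv_rhs => rw [← (κ i).disintegrate (κ i).condKernel]
  rw [Kernel.compProd_apply (hB i)]

end Disintegration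

/-! ### Symmetry and coarsening of conditional independence. -/

section ConditionalIndependence

variable {Ω 𝓗 𝓧 𝓩 : Type*} [MeasurableSpace Ω] [MeasurableSpace 𝓗] [MeasurableSpace 𝓧]
  [MeasurableSpace 𝓩] {P : Measure Ω} [IsProbabilityMeasure P] {H : Ω → 𝓗} {x : Ω → 𝓧} {z : Ω → 𝓩}

/-- If the conditional law of `z` given `(x, H)` only depends on `H`, then it is also the
conditional law of `z` given `H`. -/
lemma map_prodMk_eq_of_condLaw (hH : Measurable H) (hx : Measurable x) (hz : Measurable z)
    {κ : Kernel 𝓗 𝓩} [IsMarkovKernel κ]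
    (h : P.map (fun ω => ((x ω, H ω), z ω)) =
      P.map (fun ω => (x ω, H ω)) ⊗ₘ κ.comap Prod.snd measurable_snd) :
    P.map (fun ω => (H ω, z ω)) = P.map H ⊗ₘ κ := by
  have := Measure.isProbabilityMeasure_map (μ := P) (hH.prodMk hz).aemeasurable
  refine Measure.ext_prod fun {s t} hs ht => ?_
  have h1 := congrArg (fun μ => μ ((Set.univ ×ˢ s) ×ˢ t)) h
  beta_reduce at h1
  rw [Measure.map_apply (by fun_prop) ((MeasurableSet.univ.prod hs).prod ht),
    Measure.compProd_apply_prod (MeasurableSet.univ.prod hs) ht,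
    setLIntegral_map (MeasurableSet.univ.prod hs) (Kernel.measurable_coe _ ht) (hx.prodMk hH)] at h1
  rw [Measure.map_apply (by fun_prop) (hs.prod ht), Measure.compProd_apply_prod hs ht,
    setLIntegral_map hs (Kernel.measurable_coe _ ht) hH]
  have hs1 : (fun ω => (x ω, H ω)) ⁻¹' Set.univ ×ˢ s = H ⁻¹' s := by ext; simp
  have hs2 : (fun ω => ((x ω, H ω), z ω)) ⁻¹' (Set.univ ×ˢ s) ×ˢ t =
      (fun ω => (H ω, z ω)) ⁻¹' s ×ˢ t := by ext; simp
  rwa [hs1, hs2] at h1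

/-- If the conditional law of `z` given `(x, H)` only depends on `H`, then the conditional law of
`x` given `(H, z)` only depends on `H`. -/
lemma condLaw_symm (hH : Measurable H) (hx : Measurable x) (hz : Measurable z)
    {κ : Kernel 𝓗 𝓩} [IsMarkovKernel κ] {ρ : Kernel 𝓗 𝓧} [IsMarkovKernel ρ]
    (h : P.map (fun ω => ((x ω, H ω), z ω)) =
      P.map (fun ω => (x ω, H ω)) ⊗ₘ κ.comap Prod.snd measurable_snd)
    (hρ : P.map (fun ω => (H ω, x ω)) = P.map H ⊗ₘ ρ) :
    P.map (fun ω => ((H ω, z ω), x ω)) =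
      P.map (fun ω => (H ω, z ω)) ⊗ₘ ρ.comap Prod.fst measurable_fst := by
  have := Measure.isProbabilityMeasure_map (μ := P) hH.aemeasurable
  have := Measure.isProbabilityMeasure_map (μ := P) ((hH.prodMk hz).prodMk hx).aemeasurable
  have hHz := map_prodMk_eq_of_condLaw hH hx hz h
  refine Measure.ext_prod₃_iff'.2 fun {s t u} hs ht hu => ?_
  have h1 := congrArg (fun μ => μ ((u ×ˢ s) ×ˢ t)) h
  beta_reduce at h1
  rw [Measure.map_apply (by fun_prop) ((hu.prod hs).prod ht),
    Measure.compProd_apply_prod (hu.prod hs) ht] at h1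
  -- With the law of `(x, H)` written through `ρ`, both sides become `∫ κ h t * ρ h u` over `h ∈ s`,
  -- which is symmetric in the two kernels.
  have hswap : P.map (fun ω => (x ω, H ω)) = (P.map H ⊗ₘ ρ).map Prod.swap := by
    rw [← hρ, Measure.map_map measurable_swap (by fun_prop)]
    rfl
  rw [hswap, setLIntegral_map (hu.prod hs) (Kernel.measurable_coe _ ht) measurable_swap,
    Set.preimage_swap_prod, Measure.setLIntegral_compProd (by
      exact (Kernel.measurable_coe _ ht).comp measurable_swap) hs hu] at h1
  rw [Measure.map_apply (by fun_prop) ((hs.prod ht).prod hu),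
    Measure.compProd_apply_prod (hs.prod ht) hu, hHz,
    Measure.setLIntegral_compProd (Kernel.measurable_coe _ hu) hs ht]
  have hset : (fun ω => ((H ω, z ω), x ω)) ⁻¹' (s ×ˢ t) ×ˢ u =
      (fun ω => ((x ω, H ω), z ω)) ⁻¹' (u ×ˢ s) ×ˢ t := by
    ext; simp; tauto
  rw [hset, h1]
  refine lintegral_congr fun g => ?_
  simp [Kernel.comap_apply, mul_comm]

/-- A conditional law given `(H, z)` that only depends on `H` is a conditional law given
`(H, f z)`. -/
lemma condLaw_comp {𝓐 : Type*} [MeasurableSpace 𝓐] (hH : Measurable H) (hx : Measurable x)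
    (hz : Measurable z) {ρ : Kernel 𝓗 𝓧} [IsMarkovKernel ρ] {f : 𝓩 → 𝓐} (hf : Measurable f)
    (h : P.map (fun ω => ((H ω, z ω), x ω)) =
      P.map (fun ω => (H ω, z ω)) ⊗ₘ ρ.comap Prod.fst measurable_fst) :
    P.map (fun ω => ((H ω, f (z ω)), x ω)) =
      P.map (fun ω => (H ω, f (z ω))) ⊗ₘ ρ.comap Prod.fst measurable_fst := by
  have hfz : Measurable fun ω => f (z ω) := hf.comp hz
  have := Measure.isProbabilityMeasure_map (μ := P) ((hH.prodMk hfz).prodMk hx).aemeasurable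
  refine Measure.ext_prod fun {s t} hs ht => ?_
  have hg : Measurable fun p : 𝓗 × 𝓩 => (p.1, f p.2) := by fun_prop
  have h1 := congrArg (fun μ => μ (((fun p : 𝓗 × 𝓩 => (p.1, f p.2)) ⁻¹' s) ×ˢ t)) h
  beta_reduce at h1
  rw [Measure.map_apply (by fun_prop) ((hg hs).prod ht), Measure.compProd_apply_prod (hg hs) ht,
    setLIntegral_map (hg hs) (Kernel.measurable_coe _ ht) (hH.prodMk hz)] at h1
  rw [Measure.map_apply (by fun_prop) (hs.prod ht), Measure.compProd_apply_prod hs ht,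
    setLIntegral_map hs (Kernel.measurable_coe _ ht) (hH.prodMk hfz)]
  exact h1

end ConditionalIndependence

/-! ### Observation through independent noise. -/

section Noise

variable {Ω ι 𝓖 E F : Type*} [Fintype ι] [MeasurableSpace Ω] [MeasurableSpace 𝓖]
  [MeasurableSpace E] [MeasurableSpace F] {P : Measure Ω} [IsProbabilityMeasure P] {G : Ω → 𝓖}
  {x : Ω → ι → E} {η : ι → Ω → ℝ}

/-- Coordinatewise observations with fresh independent noise keep the coordinates independent
given `G`. -/
lemma exists_piKernel_of_noise (hG : Measurable G) (hx : Measurable x) (hη : ∀ i, Measurable (η i))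
    (ρ : ι → Kernel 𝓖 E) [∀ i, IsMarkovKernel (ρ i)]
    (h : P.map (fun ω => (G ω, x ω)) = P.map G ⊗ₘ piKernel ρ)
    (hind : iIndepFun η P) (hfresh : IndepFun (fun ω i => η i ω) (fun ω => (G ω, x ω)) P)
    (φ : ι → 𝓖 → E → ℝ → F) (hφ : ∀ i, Measurable fun p : 𝓖 × E × ℝ => φ i p.1 p.2.1 p.2.2) :
    ∃ (κ : ι → Kernel 𝓖 F) (_ : ∀ i, IsMarkovKernel (κ i)),
      P.map (fun ω => (G ω, fun i => φ i (G ω) (x ω i) (η i ω))) = P.map G ⊗ₘ piKernel κ := by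
  have := Measure.isProbabilityMeasure_map (μ := P) hG.aemeasurable
  have hν : ∀ i, IsProbabilityMeasure (P.map (η i)) := fun i =>
    Measure.isProbabilityMeasure_map (hη i).aemeasurable
  -- The law of `φ i g e n` for independent `e ∼ ρ i g` and `n` distributed as `η i`.
  let κ : ι → Kernel 𝓖 F := fun i =>
    (Kernel.id ×ₖ (ρ i ×ₖ Kernel.const 𝓖 (P.map (η i)))).map
      (fun p : 𝓖 × E × ℝ => φ i p.1 p.2.1 p.2.2)
  have hκ : ∀ i, IsMarkovKernel (κ i) := fun i => Kernel.IsMarkovKernel.map _ (hφ i)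
  have hsec : ∀ i g (B : Set F), MeasurableSet B → MeasurableSet {q : E × ℝ | φ i g q.1 q.2 ∈ B} :=
    fun i g B hB => ((hφ i).comp (by fun_prop : Measurable fun q : E × ℝ => (g, q.1, q.2))) hB
  have hκ_apply : ∀ i g (B : Set F), MeasurableSet B →
      κ i g B = ∫⁻ t, ρ i g {e | φ i g e t ∈ B} ∂P.map (η i) := by
    intro i g B hB
    rw [Kernel.map_apply' _ (hφ i) _ hB, Kernel.prod_apply, Kernel.prod_apply, Kernel.id_apply,
      Measure.dirac_prod, Measure.map_apply (by fun_prop) (hφ i hB), Kernel.const_apply,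
      Measure.prod_apply_symm]
    · rfl
    · exact hsec i g B hB
  refine ⟨κ, hκ, ?_⟩
  have hjoint : P.map (fun ω => ((fun i => η i ω), (G ω, x ω))) =
      (Measure.pi fun i => P.map (η i)).prod (P.map G ⊗ₘ piKernel ρ) := by
    rw [← h, ← (iIndepFun_iff_map_fun_eq_pi_map fun i => (hη i).aemeasurable).1 hind]
    exact (indepFun_iff_map_prod_eq_prod_map_map (by fun_prop) (by fun_prop)).1 hfresh
  have hφ' : Measurable fun ω => (G ω, fun i => φ i (G ω) (x ω i) (η i ω)) :=
    hG.prodMk (measurable_pi_lambda _ fun i => (hφ i).comp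
      (hG.prodMk (((measurable_pi_apply i).comp hx).prodMk (hη i))))
  have := Measure.isProbabilityMeasure_map (μ := P) hφ'.aemeasurable
  refine ext_prod_box fun A B hA hB => ?_
  have hm : MeasurableSet (Set.univ.pi B) := MeasurableSet.univ_pi hB
  let Ψ : (ι → ℝ) × 𝓖 × (ι → E) → 𝓖 × (ι → F) :=
    fun q => (q.2.1, fun i => φ i q.2.1 (q.2.2 i) (q.1 i))
  have hΨ : Measurable Ψ := measurable_snd.fst.prodMk (measurable_pi_lambda _ fun i => (hφ i).comp
    (by fun_prop : Measurable fun q : (ι → ℝ) × 𝓖 × (ι → E) => (q.2.1, q.2.2 i, q.1 i)))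
  have hmap : P.map (fun ω => (G ω, fun i => φ i (G ω) (x ω i) (η i ω))) =
      (P.map (fun ω => ((fun i => η i ω), (G ω, x ω)))).map Ψ := by
    rw [Measure.map_map hΨ (by fun_prop)]
    rfl
  have hmeas : Measurable fun p : 𝓖 × (ι → ℝ) => ∏ i, ρ i p.1 {e | φ i p.1 e (p.2 i) ∈ B i} := by
    refine Finset.measurable_prod _ fun i _ => ?_
    exact Kernel.measurable_kernel_prodMk_left (κ := (ρ i).comap Prod.fst measurable_fst)
      (t := {q : (𝓖 × (ι → ℝ)) × E | φ i q.1.1 q.2 (q.1.2 i) ∈ B i})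
      (((hφ i).comp (by fun_prop : Measurable fun q : (𝓖 × (ι → ℝ)) × E =>
        (q.1.1, q.2, q.1.2 i))) (hB i))
  rw [hmap, hjoint, Measure.map_apply hΨ (hA.prod hm), Measure.prod_apply (hΨ (hA.prod hm)),
    Measure.compProd_apply_prod hA hm]
  have h1 : ∀ n : ι → ℝ, (P.map G ⊗ₘ piKernel ρ) (Prod.mk n ⁻¹' (Ψ ⁻¹' A ×ˢ Set.univ.pi B)) =
      ∫⁻ g in A, ∏ i, ρ i g {e | φ i g e (n i) ∈ B i} ∂P.map G := by
    intro n
    rw [Measure.compProd_apply (measurable_prodMk_left (hΨ (hA.prod hm))),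
      ← lintegral_indicator hA]
    refine lintegral_congr fun g => ?_
    by_cases hg : g ∈ A
    · rw [Set.indicator_of_mem hg, ← Measure.pi_pi, ← piKernel_apply]
      congr 1; ext e; simp [Ψ, hg]
    · rw [Set.indicator_of_notMem hg]
      convert measure_empty (μ := piKernel ρ g)
      ext e; simp [Ψ, hg]
  simp only [h1]
  -- With `g` outside, the integrand is a product of functions of single noise coordinates, so the
  -- noise integral factors.
  rw [lintegral_lintegral_swap
    (f := fun (n : ι → ℝ) (g : 𝓖) => ∏ i, ρ i g {e | φ i g e (n i) ∈ B i})
    (hmeas.comp measurable_swap).aemeasurable]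
  refine lintegral_congr fun g => ?_
  rw [piKernel_apply, Measure.pi_pi,
    lintegral_pi_prod (f := fun i t => ρ i g {e | φ i g e t ∈ B i})]
  · exact Finset.prod_congr rfl fun i _ => (hκ_apply i g _ (hB i)).symm
  · intro i
    exact Kernel.measurable_kernel_prodMk_left (κ := Kernel.const ℝ (ρ i g))
      (t := {q : ℝ × E | φ i g q.2 q.1 ∈ B i})
      ((hsec i g _ (hB i)).preimage measurable_swap)

end Noise

/-! ### Changing the kernel or the conditioning variable. -/

section CondLaw

variable {Ω 𝓗 𝓧 : Type*} [MeasurableSpace Ω] [MeasurableSpace 𝓗] [MeasurableSpace 𝓧]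
  {P : Measure Ω} [IsProbabilityMeasure P] {H : Ω → 𝓗} {x : Ω → 𝓧}

lemma map_compProd_congr (hH : Measurable H) {κ ρ : Kernel 𝓗 𝓧} [IsMarkovKernel κ]
    [IsMarkovKernel ρ] (h : ∀ᵐ ω ∂P, κ (H ω) = ρ (H ω)) : P.map H ⊗ₘ κ = P.map H ⊗ₘ ρ := by
  have := Measure.isProbabilityMeasure_map (μ := P) hH.aemeasurable
  refine Measure.ext_prod fun {s t} hs ht => ?_
  rw [Measure.compProd_apply_prod hs ht, Measure.compProd_apply_prod hs ht,
    setLIntegral_map hs (Kernel.measurable_coe _ ht) hH,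
    setLIntegral_map hs (Kernel.measurable_coe _ ht) hH]
  refine lintegral_congr_ae (ae_restrict_of_ae ?_)
  filter_upwards [h] with ω hω
  rw [hω]

/-- Transport of a conditional law along a bijective measurable change of the conditioning
variable. -/
lemma condLaw_of_bijection {𝓨 : Type*} [MeasurableSpace 𝓨] {y : Ω → 𝓨} (hH : Measurable H)
    (hx : Measurable x) (hy : Measurable y) {f : 𝓨 → 𝓗} (hf : Measurable f) {g : 𝓗 → 𝓨}
    (hg : Measurable g) (hfy : ∀ ω, H ω = f (y ω)) (hgH : ∀ ω, y ω = g (H ω)) {κ : Kernel 𝓨 𝓧}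
    [IsMarkovKernel κ] (h : P.map (fun ω => (y ω, x ω)) = P.map y ⊗ₘ κ) :
    P.map (fun ω => (H ω, x ω)) = P.map H ⊗ₘ κ.comap g hg := by
  have := Measure.isProbabilityMeasure_map (μ := P) (hH.prodMk hx).aemeasurable
  refine Measure.ext_prod fun {s t} hs ht => ?_
  have h1 := congrArg (fun μ => μ ((f ⁻¹' s) ×ˢ t)) h
  beta_reduce at h1
  rw [Measure.map_apply (by fun_prop) ((hf hs).prod ht), Measure.compProd_apply_prod (hf hs) ht,
    setLIntegral_map (hf hs) (Kernel.measurable_coe _ ht) hy] at h1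
  rw [Measure.map_apply (by fun_prop) (hs.prod ht), Measure.compProd_apply_prod hs ht,
    setLIntegral_map hs (Kernel.measurable_coe _ ht) hH]
  have hs1 : y ⁻¹' (f ⁻¹' s) = H ⁻¹' s := by ext ω; simp [hfy]
  have hs2 : (fun ω => (y ω, x ω)) ⁻¹' (f ⁻¹' s) ×ˢ t = (fun ω => (H ω, x ω)) ⁻¹' s ×ˢ t := by
    ext ω; simp [hfy]
  rw [hs1, hs2] at h1
  rw [h1]
  refine lintegral_congr fun ω => ?_
  rw [Kernel.comap_apply, hgH]

end CondLaw

/-! ### The true and the sampled parameters are exchangeable given the history. -/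

section Exchange

variable {Ω : Type*} [MeasurableSpace Ω] {d L K : ℕ} {M : Model d L K}
  {Q : Fin L → Measure (EuclideanSpace ℝ (Fin d))} {T : ℕ} {P : Measure Ω}
  [IsProbabilityMeasure P] (R : RankTSRun M Q T P)

/-- The history before round `t` of a run. -/
abbrev RankTSRun.H (t : ℕ) : Ω → Fin t → Action L K × (Fin L → ℝ) := history R.a R.r t

/-- The list played for a parameter vector. -/
def RankTSRun.best (ϑ : Params d L) : Action L K := pathAction (R.solver ϑ)

lemma Model.measurable_actionFeature (M : Model d L K) (l : Fin L) :
    Measurable fun a : Action L K => M.actionFeature a l := measurable_of_countable _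

lemma RankTSRun.measurable_best : Measurable R.best := R.measurable_solver

lemma RankTSRun.a_eq {t : ℕ} (ht : t < T) : R.a t = fun ω => R.best (R.θhat t ω) :=
  funext (R.action_eq t ht)

lemma RankTSRun.measurable_a {t : ℕ} (ht : t < T) : Measurable (R.a t) := by
  rw [R.a_eq ht]
  exact R.measurable_best.comp (R.measurable_θhat t ht)

lemma RankTSRun.measurable_θ_apply (l : Fin L) : Measurable fun ω => R.θ ω l :=
  (measurable_pi_apply l).comp R.measurable_θ

lemma RankTSRun.measurable_r {t : ℕ} (ht : t < T) (l : Fin L) : Measurable (R.r t l) := by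
  rw [funext (R.reward_eq t ht l)]
  exact ((R.measurable_θ_apply l).inner
    ((M.measurable_actionFeature l).comp (R.measurable_a ht))).add (R.measurable_η t ht l)

lemma RankTSRun.measurable_H {t : ℕ} (ht : t ≤ T) : Measurable (R.H t) :=
  measurable_pi_lambda _ fun s => (R.measurable_a (s.2.trans_le ht)).prodMk
    (measurable_pi_lambda _ fun l => R.measurable_r (s.2.trans_le ht) l)

/-- The posterior of `θ^l` before round `t`. -/
abbrev RankTSRun.posterior (t : ℕ) (l : Fin L) :
    Kernel (Fin t → Action L K × (Fin L → ℝ)) (EuclideanSpace ℝ (Fin d)) :=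
  condDistrib (fun ω => R.θ ω l) (R.H t) P

/-- The factors of a conditional product law are the conditional laws of the coordinates, and these
are almost everywhere unique. The induction therefore only has to produce some factorization. -/
lemma RankTSRun.map_H_θ_of_exists {t : ℕ} (ht : t ≤ T)
    (h : ∃ (κ : Fin L → Kernel (Fin t → Action L K × (Fin L → ℝ)) (EuclideanSpace ℝ (Fin d)))
      (_ : ∀ l, IsMarkovKernel (κ l)),
      P.map (fun ω => (R.H t ω, R.θ ω)) = P.map (R.H t) ⊗ₘ piKernel κ) :
    P.map (fun ω => (R.H t ω, R.θ ω)) = P.map (R.H t) ⊗ₘ piKernel (R.posterior t) := by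
  obtain ⟨κ, hκ, h⟩ := h
  rw [h]
  refine Measure.compProd_congr ?_
  have hl : ∀ l, R.posterior t l =ᵐ[P.map (R.H t)] κ l := fun l =>
    condDistrib_ae_eq_of_measure_eq_compProd _ (R.measurable_θ_apply l).aemeasurable
      (map_eval_of_compProd_piKernel κ (R.measurable_H ht) R.measurable_θ_apply h l)
  filter_upwards [ae_all_iff.2 hl] with g hg
  rw [piKernel_apply, piKernel_apply]
  simp only [hg]

lemma RankTSRun.map_θ_H_θhat {t : ℕ} (ht : t < T) :
    P.map (fun ω => ((R.θ ω, R.H t ω), R.θhat t ω)) =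
      P.map (fun ω => (R.θ ω, R.H t ω)) ⊗ₘ
        (piKernel (R.posterior t)).comap Prod.snd measurable_snd := by
  rw [← compProd_map_condDistrib (R.measurable_θhat t ht).aemeasurable]
  refine map_compProd_congr (R.measurable_θ.prodMk (R.measurable_H ht.le)) ?_
  filter_upwards [R.sample_law t ht] with ω hω
  rw [hω, Kernel.comap_apply, piKernel_apply]

lemma history_succ_measurable (t : ℕ) :
    Measurable fun p : ((Fin t → Action L K × (Fin L → ℝ)) × Action L K) × (Fin L → ℝ) =>
      (Fin.snoc p.1.1 (p.1.2, p.2) : Fin (t + 1) → Action L K × (Fin L → ℝ)) := by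
  refine measurable_pi_lambda _ fun i => ?_
  refine Fin.lastCases ?_ (fun j => ?_) i
  · simp only [Fin.snoc_last]; fun_prop
  · simp only [Fin.snoc_castSucc]; fun_prop

/-- Before each round the parameters `θ^l` are independent given the history. -/
lemma RankTSRun.exists_piKernel [∀ l, IsProbabilityMeasure (Q l)] {t : ℕ} (ht : t ≤ T) :
    ∃ (κ : Fin L → Kernel (Fin t → Action L K × (Fin L → ℝ)) (EuclideanSpace ℝ (Fin d)))
      (_ : ∀ l, IsMarkovKernel (κ l)),
      P.map (fun ω => (R.H t ω, R.θ ω)) = P.map (R.H t) ⊗ₘ piKernel κ := by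
  induction t with
  | zero =>
    refine ⟨fun l => Kernel.const _ (Q l), fun l => inferInstance, ?_⟩
    have hconst : piKernel (fun l => Kernel.const (Fin 0 → Action L K × (Fin L → ℝ)) (Q l)) =
        Kernel.const _ (P.map R.θ) := by
      ext1 g
      rw [piKernel_apply, Kernel.const_apply, R.law_θ]
      rfl
    have := Measure.isProbabilityMeasure_map (μ := P) R.measurable_θ.aemeasurable
    have := Measure.isProbabilityMeasure_map (μ := P) (R.measurable_H ht).aemeasurable
    rw [hconst, Measure.compProd_const,
      ← (indepFun_iff_map_prod_eq_prod_map_map (R.measurable_H ht).aemeasurable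
        R.measurable_θ.aemeasurable).1]
    have : R.H 0 = fun _ => Fin.elim0 := by
      funext ω; exact Subsingleton.elim _ _
    rw [this]
    exact indepFun_const_left _ _
  | succ t ih =>
    have ht' : t < T := ht
    have h1 := R.map_H_θ_of_exists ht'.le (ih ht'.le)
    have h2 := condLaw_symm (R.measurable_H ht'.le) R.measurable_θ (R.measurable_θhat t ht')
      (R.map_θ_H_θhat ht') h1
    -- Being a function of `θhat`, the played list tells nothing about `θ` beyond the history.
    have h3 := condLaw_comp (R.measurable_H ht'.le) R.measurable_θ (R.measurable_θhat t ht')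
      R.measurable_best h2
    let ρ : Fin L → Kernel ((Fin t → Action L K × (Fin L → ℝ)) × Action L K)
        (EuclideanSpace ℝ (Fin d)) := fun l => (R.posterior t l).comap Prod.fst measurable_fst
    have hG : Measurable fun ω => (R.H t ω, R.best (R.θhat t ω)) :=
      (R.measurable_H ht'.le).prodMk (R.measurable_best.comp (R.measurable_θhat t ht'))
    have hfresh : IndepFun (fun ω l => R.η t l ω)
        (fun ω => ((R.H t ω, R.best (R.θhat t ω)), R.θ ω)) P :=
      (R.noise_fresh t ht').comp measurable_id
        (((measurable_snd.fst).prodMk (R.measurable_best.comp measurable_snd.snd)).prodMk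
          measurable_fst)
    have hind : iIndepFun (fun l => R.η t l) P :=
      R.noise_indep.precomp (g := fun l : Fin L => ((⟨t, ht'⟩ : Fin T), l))
        fun l l' h => (Prod.mk.inj h).2
    -- The output keeps the parameter next to its reward, so that the pairs are independent and the
    -- rewards can then be moved into the conditioning.
    obtain ⟨κ, hκ, h4⟩ := exists_piKernel_of_noise hG R.measurable_θ (R.measurable_η t ht') ρ
      h3 hind hfresh (fun l g e n => (inner ℝ e (M.actionFeature g.2 l) + n, e)) (fun l =>
        (((measurable_snd.fst).inner ((M.measurable_actionFeature l).comp
          measurable_fst.snd)).add measurable_snd.snd).prodMk measurable_snd.fst)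
    have hr : Measurable fun ω l => R.r t l ω := measurable_pi_lambda _ (R.measurable_r ht')
    have h5 : P.map (fun ω => ((R.H t ω, R.best (R.θhat t ω)), fun l => (R.r t l ω, R.θ ω l))) =
        P.map (fun ω => (R.H t ω, R.best (R.θhat t ω))) ⊗ₘ piKernel κ := by
      rw [← h4]
      simp only [R.reward_eq t ht', R.a_eq ht']
    obtain ⟨κ', hκ', h6⟩ := exists_piKernel_of_pairs hG R.measurable_θ hr κ h5
    have hg : Measurable fun h : Fin (t + 1) → Action L K × (Fin L → ℝ) =>
      (((fun s : Fin t => h s.castSucc), (h (Fin.last t)).1), (h (Fin.last t)).2) := by fun_prop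
    refine ⟨fun l => (κ' l).comap _ hg, fun l => inferInstance, ?_⟩
    refine condLaw_of_bijection (R.measurable_H ht) R.measurable_θ (hG.prodMk hr)
      (history_succ_measurable t) hg (fun ω => ?_) (fun ω => ?_) h6
    · funext i
      refine Fin.lastCases ?_ (fun j => ?_) i
      · simp [history, R.a_eq ht']
      · simp [history]
    · simp [history, R.a_eq ht']
      rfl

/-- The true and the sampled parameters have the same joint law with the history. -/
theorem RankTSRun.map_H_θ_eq_map_H_θhat [∀ l, IsProbabilityMeasure (Q l)] {t : ℕ}
    (ht : t < T) :
    P.map (fun ω => (R.H t ω, R.θ ω)) = P.map (fun ω => (R.H t ω, R.θhat t ω)) := by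
  rw [R.map_H_θ_of_exists ht.le (R.exists_piKernel ht.le)]
  exact (map_prodMk_eq_of_condLaw (R.measurable_H ht.le) R.measurable_θ (R.measurable_θhat t ht)
    (R.map_θ_H_θhat ht)).symm

end Exchange

/-! ### Gram matrices, Gaussian integrals, elliptical potential and least squares. -/

section Gram

open Matrix

variable {n : Type*} [DecidableEq n]

/-- The regularized Gram matrix `lam I + ∑_{s < t} x_s x_sᵀ`. -/
def gram (lam : ℝ) (x : ℕ → n → ℝ) (t : ℕ) : Matrix n n ℝ :=
  lam • 1 + ∑ s ∈ Finset.range t, vecMulVec (x s) (x s)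

lemma gram_succ {lam : ℝ} {x : ℕ → n → ℝ} (t : ℕ) :
    gram lam x (t + 1) = gram lam x t + vecMulVec (x t) (x t) := by
  rw [gram, gram, Finset.sum_range_succ, add_assoc]

end Gram

section QuadraticForms

open Matrix

variable {n : Type*} [Fintype n] [DecidableEq n]

/-- A positive definite real matrix is `Bᵀ B` for an invertible `B`. -/
lemma exists_transpose_mul_self {A : Matrix n n ℝ} (hA : A.PosDef) :
    ∃ B : Matrix n n ℝ, A = Bᵀ * B ∧ B.det ≠ 0 := by
  open scoped MatrixOrder in
  obtain ⟨B, hB⟩ := CStarAlgebra.nonneg_iff_eq_star_mul_self.mp hA.posSemidef.nonneg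
  rw [star_eq_conjTranspose, conjTranspose_eq_transpose_of_trivial] at hB
  refine ⟨B, hB, fun h => ?_⟩
  have := hA.det_pos
  rw [hB, det_mul, h] at this
  simp at this

/-- The quadratic form `y ↦ yᵀ A⁻¹ y`. -/
def invForm (A : Matrix n n ℝ) (y : n → ℝ) : ℝ := y ⬝ᵥ A⁻¹ *ᵥ y

lemma invForm_nonneg {A : Matrix n n ℝ} (hA : A.PosDef) (y : n → ℝ) : 0 ≤ invForm A y := by
  simpa [invForm] using hA.inv.posSemidef.dotProduct_mulVec_nonneg y

lemma dotProduct_inv_mulVec_sq_le {A : Matrix n n ℝ} (hA : A.PosDef) (x y : n → ℝ) :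
    (x ⬝ᵥ A⁻¹ *ᵥ y) ^ 2 ≤ invForm A x * invForm A y := by
  obtain ⟨B, hB, -⟩ := exists_transpose_mul_self hA.inv
  have h : ∀ u v : n → ℝ, u ⬝ᵥ A⁻¹ *ᵥ v = ∑ i, (B *ᵥ u) i * (B *ᵥ v) i := by
    intro u v
    rw [hB, ← mulVec_mulVec, dotProduct_mulVec, vecMul_transpose]
    rfl
  rw [invForm, invForm, h, h, h]
  simpa only [sq] using Finset.sum_mul_sq_le_sq_mul_sq Finset.univ (B *ᵥ x) (B *ᵥ y)

lemma abs_dotProduct_inv_mulVec_le {A : Matrix n n ℝ} (hA : A.PosDef) (x y : n → ℝ) :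
    |x ⬝ᵥ A⁻¹ *ᵥ y| ≤ √(invForm A x) * √(invForm A y) := by
  rw [← Real.sqrt_mul (invForm_nonneg hA x), ← Real.sqrt_sq_eq_abs]
  exact Real.sqrt_le_sqrt (dotProduct_inv_mulVec_sq_le hA x y)

/-- `det A ≤ (tr A / n) ^ n`. -/
lemma log_det_le [Nonempty n] {A : Matrix n n ℝ} (hA : A.PosDef) :
    Real.log A.det ≤ Fintype.card n * Real.log (A.trace / Fintype.card n) := by
  have hpos := hA.eigenvalues_pos
  have hn : (0 : ℝ) < Fintype.card n := by exact_mod_cast Fintype.card_pos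
  have h := Real.geom_mean_le_arith_mean Finset.univ (fun _ : n => (1 : ℝ))
    hA.isHermitian.eigenvalues
    (by simp) (by simp; exact Fintype.card_pos) fun i _ => (hpos i).le
  simp only [Real.rpow_one, Finset.sum_const, Finset.card_univ, nsmul_eq_mul, mul_one, one_mul] at h
  have hd : A.det = ∏ i, hA.isHermitian.eigenvalues i := by
    simpa using hA.isHermitian.det_eq_prod_eigenvalues
  have ht : A.trace = ∑ i, hA.isHermitian.eigenvalues i := by
    simpa using hA.isHermitian.trace_eq_sum_eigenvalues
  rw [← hd, ← ht] at h
  have h2 := Real.log_le_log (Real.rpow_pos_of_pos hA.det_pos _) h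
  rw [Real.log_rpow hA.det_pos] at h2
  calc Real.log A.det = Fintype.card n * ((Fintype.card n : ℝ)⁻¹ * Real.log A.det) := by
        field_simp
    _ ≤ _ := mul_le_mul_of_nonneg_left h2 hn.le

lemma det_add_vecMulVec {A : Matrix n n ℝ} (hA : A.PosDef) (x : n → ℝ) :
    (A + vecMulVec x x).det = A.det * (1 + invForm A x) := by
  have h := det_add_replicateCol_mul_replicateRow (ι := Unit)
    ((isUnit_iff_isUnit_det A).1 hA.isUnit) x x
  rw [← vecMulVec_eq] at h
  rw [h, det_unique (n := Unit)]
  congr 1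
  simp [invForm, Matrix.mul_assoc, dotProduct, mulVec,
    Matrix.mul_apply]

/-- The Gaussian integral `∫ exp (u ⬝ S - uᵀ A u / 2) du`. -/
lemma lintegral_gaussian {A : Matrix n n ℝ} (hA : A.PosDef) (S : n → ℝ) :
    ∫⁻ u : n → ℝ, ENNReal.ofReal (Real.exp (u ⬝ᵥ S - (u ⬝ᵥ A *ᵥ u) / 2)) =
      ENNReal.ofReal ((√(2 * Real.pi)) ^ Fintype.card n * (√A.det)⁻¹ *
        Real.exp (invForm A S / 2)) := by
  obtain ⟨B, hB, hdet⟩ := exists_transpose_mul_self hA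
  have hBu : IsUnit B.det := isUnit_iff_ne_zero.2 hdet
  -- After the substitution `y = B u` the exponent is `∑ (c i * y i - y i ^ 2 / 2)`, and each `f i`
  -- is a multiple of the Gaussian density with mean `c i`.
  let c := (B⁻¹)ᵀ *ᵥ S
  let f : n → ℝ → ℝ := fun i y =>
    (√(2 * Real.pi) * Real.exp (c i ^ 2 / 2)) * gaussianPDFReal (c i) 1 y
  have hf : ∀ i y, f i y = Real.exp (c i * y - y ^ 2 / 2) := by
    intro i y
    have : √(2 * Real.pi) ≠ 0 := by positivity
    simp only [f, gaussianPDFReal, NNReal.coe_one, mul_one]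
    field_simp
    rw [← Real.exp_add]
    congr 1
    ring
  have h1 : ∀ u : n → ℝ, Real.exp (u ⬝ᵥ S - (u ⬝ᵥ A *ᵥ u) / 2) = ∏ i, f i (toLin' B u i) := by
    intro u
    simp only [hf]
    rw [← Real.exp_sum]
    congr 1
    have e1 : u ⬝ᵥ A *ᵥ u = ∑ i, (B *ᵥ u) i ^ 2 := by
      rw [hB, ← mulVec_mulVec, dotProduct_mulVec, vecMul_transpose]
      simp [dotProduct, sq]
    have e2 : u ⬝ᵥ S = ∑ i, c i * (B *ᵥ u) i := by
      have : u ⬝ᵥ S = c ⬝ᵥ B *ᵥ u := by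
        simp only [c]
        rw [dotProduct_mulVec, vecMul_mulVec, transpose_transpose, dotProduct_comm,
          nonsing_inv_mul B hBu, vecMul_one]
      rw [this, dotProduct]
    rw [e1, e2, Finset.sum_sub_distrib, Finset.sum_div]
    simp
  have hfm : Measurable fun y : n → ℝ => ENNReal.ofReal (∏ i, f i (y i)) := by
    simp only [hf]; fun_prop
  have hfi : ∀ i, Integrable (f i) := fun i => (integrable_gaussianPDFReal _ _).const_mul _
  have hfint : ∀ i, ∫ y, f i y = √(2 * Real.pi) * Real.exp (c i ^ 2 / 2) := by
    intro i
    rw [integral_const_mul, integral_gaussianPDFReal_eq_one _ one_ne_zero, mul_one]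
  have hlin : Measurable (toLin' B) := (LinearMap.continuous_on_pi _).measurable
  simp only [h1]
  rw [← lintegral_map hfm hlin, Real.map_matrix_volume_pi_eq_smul_volume_pi hdet,
    lintegral_smul_measure, ← ofReal_integral_eq_lintegral_ofReal,
    integral_fintype_prod_volume_eq_prod, smul_eq_mul, ← ENNReal.ofReal_mul (abs_nonneg _)]
  · congr 1
    simp only [hfint]
    rw [Finset.prod_mul_distrib, Finset.prod_const, Finset.card_univ, ← Real.exp_sum,
      ← Finset.sum_div]
    have e3 : √A.det = |B.det| := by
      rw [hB, det_mul, det_transpose, ← sq, Real.sqrt_sq_eq_abs]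
    have e4 : invForm A S = ∑ i, c i ^ 2 := by
      rw [invForm, hB, Matrix.mul_inv_rev, ← mulVec_mulVec, dotProduct_mulVec,
        ← transpose_nonsing_inv, ← mulVec_transpose]
      simp [c, dotProduct, sq]
    rw [e3, e4, abs_inv]
    ring
  · exact Integrable.fintype_prod hfi
  · exact Filter.Eventually.of_forall fun y => Finset.prod_nonneg fun i _ => by
      rw [hf]; exact (Real.exp_pos _).le

variable {lam : ℝ} {x : ℕ → n → ℝ}

lemma gram_posDef (hlam : 0 < lam) (t : ℕ) : (gram lam x t).PosDef := by
  refine (PosDef.one.smul hlam).add_posSemidef (posSemidef_sum _ fun s _ => ?_)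
  simpa using posSemidef_vecMulVec_self_star (x s)

lemma gram_trace (t : ℕ) :
    (gram lam x t).trace = Fintype.card n * lam + ∑ s ∈ Finset.range t, x s ⬝ᵥ x s := by
  simp [gram, trace_add, trace_sum, trace_vecMulVec, mul_comm]

lemma gram_det_succ (hlam : 0 < lam) (t : ℕ) :
    (gram lam x (t + 1)).det = (gram lam x t).det * (1 + invForm (gram lam x t) (x t)) := by
  rw [gram_succ, det_add_vecMulVec (gram_posDef hlam t)]

lemma gram_quadratic (t : ℕ) (u : n → ℝ) :
    u ⬝ᵥ gram lam x t *ᵥ u = lam * (u ⬝ᵥ u) + ∑ s ∈ Finset.range t, (u ⬝ᵥ x s) ^ 2 := by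
  rw [gram, add_mulVec, dotProduct_add, sum_mulVec, dotProduct_sum, smul_mulVec, one_mulVec,
    dotProduct_smul, smul_eq_mul]
  congr 1
  refine Finset.sum_congr rfl fun s _ => ?_
  rw [vecMulVec_mulVec, dotProduct_smul, dotProduct_comm (x s) u]
  simp [sq]

/-- `log (det V_t / lam ^ n)`. -/
def logDet (lam : ℝ) (x : ℕ → n → ℝ) (t : ℕ) : ℝ :=
  Real.log ((gram lam x t).det / lam ^ Fintype.card n)

lemma logDet_zero (hlam : 0 < lam) : logDet lam x 0 = 0 := by
  have : lam ^ Fintype.card n ≠ 0 := (pow_pos hlam _).ne'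
  simp [logDet, gram, this]

lemma logDet_succ (hlam : 0 < lam) (t : ℕ) :
    logDet lam x (t + 1) = logDet lam x t + Real.log (1 + invForm (gram lam x t) (x t)) := by
  have h1 := (gram_posDef (x := x) hlam t).det_pos
  have h2 := pow_pos hlam (Fintype.card n)
  have h3 := invForm_nonneg (gram_posDef (x := x) hlam t) (x t)
  rw [logDet, logDet, gram_det_succ hlam, mul_div_right_comm, Real.log_mul (by positivity)
    (by positivity)]

lemma logDet_mono (hlam : 0 < lam) : Monotone (logDet lam x) :=
  monotone_nat_of_le_succ fun t => by
    rw [logDet_succ hlam]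
    have := invForm_nonneg (gram_posDef (x := x) hlam t) (x t)
    linarith [Real.log_nonneg (by linarith : 1 ≤ 1 + invForm (gram lam x t) (x t))]

/-- The determinant is controlled by the trace through the AM-GM inequality for eigenvalues, and
each rank-one update adds at most `b` to the trace. -/
lemma logDet_le (hlam : 0 < lam) {b : ℝ} {t : ℕ} (hx : ∀ s < t, x s ⬝ᵥ x s ≤ b) :
    logDet lam x t ≤ Fintype.card n * Real.log (1 + t * b / (Fintype.card n * lam)) := by
  rcases isEmpty_or_nonempty n with hn | hn
  · simp [logDet]
  have hc : (0 : ℝ) < Fintype.card n := by exact_mod_cast Fintype.card_pos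
  have hA := gram_posDef (x := x) hlam t
  have h1 := log_det_le hA
  have h2 := Real.log_le_log (div_pos hA.trace_pos hc)
    (y := lam * (1 + t * b / (Fintype.card n * lam)))
    (by
      rw [gram_trace]
      have : ∑ s ∈ Finset.range t, x s ⬝ᵥ x s ≤ t * b := by
        calc _ ≤ ∑ s ∈ Finset.range t, b :=
              Finset.sum_le_sum fun s hs => hx s (Finset.mem_range.1 hs)
          _ = t * b := by simp
      rw [div_le_iff₀ hc]
      calc _ ≤ Fintype.card n * lam + t * b := by linarith
        _ = _ := by field_simp)
  have hpos : 0 < 1 + t * b / (Fintype.card n * lam) := by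
    have := div_pos hA.trace_pos hc
    -- The hypothesis makes `b` nonnegative only when some `s < t` exists; for `t = 0` the fraction
    -- vanishes.
    rcases Nat.eq_zero_or_pos t with rfl | ht
    · simp
    · have hb : 0 ≤ b := le_trans (by simpa using dotProduct_star_self_nonneg (x 0)) (hx 0 ht)
      positivity
  rw [Real.log_mul hlam.ne' hpos.ne'] at h2
  rw [logDet, Real.log_div hA.det_pos.ne' (pow_pos hlam _).ne', Real.log_pow]
  nlinarith [mul_le_mul_of_nonneg_left h2 hc.le]

/-- From `log (1 + y) ≥ y / (1 + y)`. The constant `2` is the one under the root of the final bound.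
-/
lemma min_one_le_two_mul_log {y : ℝ} (hy : 0 ≤ y) : min 1 y ≤ 2 * Real.log (1 + y) := by
  have h := Real.one_sub_inv_le_log_of_pos (by linarith : 0 < 1 + y)
  have h2 : 1 - (1 + y)⁻¹ = y / (1 + y) := by field_simp; ring
  rw [h2] at h
  have h3 : min 1 y / 2 ≤ y / (1 + y) := by
    rw [div_le_div_iff₀ two_pos (by linarith)]
    rcases le_total y 1 with h1 | h1
    · rw [min_eq_right h1]; nlinarith
    · rw [min_eq_left h1]; linarith
  linarith

/-- The elliptical potential lemma. -/
lemma sum_min_one_invForm_le (hlam : 0 < lam) (T : ℕ) :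
    ∑ t ∈ Finset.range T, min 1 (invForm (gram lam x t) (x t)) ≤ 2 * logDet lam x T := by
  induction T with
  | zero => simp [logDet_zero hlam]
  | succ T ih =>
    rw [Finset.sum_range_succ, logDet_succ hlam]
    have := min_one_le_two_mul_log (invForm_nonneg (gram_posDef (x := x) hlam T) (x T))
    linarith

/-- `‖θ‖²_{V⁻¹} ≤ ‖θ‖² / lam`. -/
lemma invForm_gram_le (hlam : 0 < lam) (t : ℕ) (y : n → ℝ) :
    lam * invForm (gram lam x t) y ≤ y ⬝ᵥ y := by
  have hA := gram_posDef (x := x) hlam t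
  set z := (gram lam x t)⁻¹ *ᵥ y with hz
  have hAz : gram lam x t *ᵥ z = y := by
    rw [hz, mulVec_mulVec, mul_nonsing_inv _ ((isUnit_iff_isUnit_det _).1 hA.isUnit), one_mulVec]
  have h1 : invForm (gram lam x t) y = y ⬝ᵥ z := rfl
  have h2 : lam * (z ⬝ᵥ z) ≤ y ⬝ᵥ z := by
    rw [dotProduct_comm y z]
    conv_rhs => rw [← hAz]
    rw [gram_quadratic]
    have := Finset.sum_nonneg fun s (_ : s ∈ Finset.range t) => sq_nonneg (z ⬝ᵥ x s)
    linarith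
  -- Expanding this square and inserting `h2` leaves `lam * (y ⬝ᵥ z) ≤ y ⬝ᵥ y`.
  have h3 : 0 ≤ (y - lam • z) ⬝ᵥ (y - lam • z) := by
    simpa using dotProduct_star_self_nonneg (y - lam • z)
  simp only [sub_dotProduct, dotProduct_sub, smul_dotProduct, dotProduct_smul, smul_eq_mul,
    dotProduct_comm z y] at h3
  rw [h1]
  nlinarith [mul_le_mul_of_nonneg_left h2 hlam.le]

/-- The deviation of the regularized least squares estimate, with noise `e`. -/
lemma abs_dotProduct_leastSquares_sub_le (hlam : 0 < lam) (t : ℕ) (θ : n → ℝ) (e : ℕ → ℝ)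
    (hθ : lam * (θ ⬝ᵥ θ) ≤ 1) (y : n → ℝ) :
    |y ⬝ᵥ (gram lam x t)⁻¹ *ᵥ (∑ s ∈ Finset.range t, (θ ⬝ᵥ x s + e s) • x s) - y ⬝ᵥ θ| ≤
      √(invForm (gram lam x t) y) *
        (1 + √(invForm (gram lam x t) (∑ s ∈ Finset.range t, e s • x s))) := by
  have hA := gram_posDef (x := x) hlam t
  have hAθ : gram lam x t *ᵥ θ = lam • θ + ∑ s ∈ Finset.range t, (θ ⬝ᵥ x s) • x s := by
    rw [gram, add_mulVec, sum_mulVec, smul_mulVec, one_mulVec]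
    congr 1
    refine Finset.sum_congr rfl fun s _ => ?_
    rw [vecMulVec_mulVec, dotProduct_comm (x s) θ]
    simp
  -- The estimation error is a noise term minus the bias `lam V⁻¹ θ` of the regularization.
  have hsplit : (∑ s ∈ Finset.range t, (θ ⬝ᵥ x s + e s) • x s) =
      gram lam x t *ᵥ θ + (∑ s ∈ Finset.range t, e s • x s) - lam • θ := by
    rw [hAθ]
    simp only [add_smul, Finset.sum_add_distrib]
    abel
  have hinv : (gram lam x t)⁻¹ *ᵥ (gram lam x t *ᵥ θ) = θ := by
    rw [mulVec_mulVec, nonsing_inv_mul _ ((isUnit_iff_isUnit_det _).1 hA.isUnit), one_mulVec]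
  rw [hsplit, mulVec_sub, mulVec_add, hinv, mulVec_smul, dotProduct_sub, dotProduct_add,
    dotProduct_smul, smul_eq_mul]
  have h1 := abs_dotProduct_inv_mulVec_le hA y (∑ s ∈ Finset.range t, e s • x s)
  have h2 := abs_dotProduct_inv_mulVec_le hA y θ
  -- The bias contributes at most `1`, because `lam * ‖θ‖² ≤ 1`; this is the summand `1` of `β`.
  have h3 : lam * √(invForm (gram lam x t) θ) ≤ 1 := by
    refine le_of_abs_le (abs_le_one_iff_mul_self_le_one.2 ?_)
    have h4 := invForm_gram_le (x := x) hlam t θ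
    have h5 := Real.mul_self_sqrt (invForm_nonneg hA θ)
    calc _ = lam * (lam * (√(invForm (gram lam x t) θ) * √(invForm (gram lam x t) θ))) := by ring
      _ ≤ 1 := by rw [h5]; exact (mul_le_mul_of_nonneg_left h4 hlam.le).trans hθ
  have h6 : |lam * y ⬝ᵥ (gram lam x t)⁻¹ *ᵥ θ| ≤ √(invForm (gram lam x t) y) := by
    rw [abs_mul, abs_of_pos hlam]
    nlinarith [mul_le_mul_of_nonneg_left h2 hlam.le, Real.sqrt_nonneg (invForm (gram lam x t) y),
      mul_le_mul_of_nonneg_left h3 (Real.sqrt_nonneg (invForm (gram lam x t) y))]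
  rw [abs_le] at h1 h6 ⊢
  constructor <;> linarith

end QuadraticForms

/-! ### Exponential supermartingales for subgaussian noise. -/

section Supermartingale

open Matrix

variable {Ω n : Type*} [Fintype n] [MeasurableSpace Ω] {P : Measure Ω} [IsProbabilityMeasure P]
  {x : ℕ → Ω → n → ℝ} {e : ℕ → Ω → ℝ} {t : ℕ}

/-- One step of the supermartingale: for fixed `Z` the exponential factor has mean at most one by
subgaussianity. Here `W` stands for the product over the past; with values in `ℝ≥0∞` it needs no
integrability. -/
lemma lintegral_mul_exp_le {𝓩 : Type*} [MeasurableSpace 𝓩] {Z : Ω → 𝓩} {η : Ω → ℝ}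
    (hZ : Measurable Z) (hη : Measurable η) (hind : IndepFun η Z P)
    (hsub : HasSubgaussianMGF η 1 P) {W : 𝓩 → ℝ≥0∞} (hW : Measurable W) {c : 𝓩 → ℝ}
    (hc : Measurable c) :
    ∫⁻ ω, W (Z ω) * ENNReal.ofReal (Real.exp (η ω * c (Z ω) - c (Z ω) ^ 2 / 2)) ∂P ≤
      ∫⁻ ω, W (Z ω) ∂P := by
  have := Measure.isProbabilityMeasure_map (μ := P) hZ.aemeasurable
  have := Measure.isProbabilityMeasure_map (μ := P) hη.aemeasurable
  have hF : Measurable fun p : 𝓩 × ℝ =>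
      W p.1 * ENNReal.ofReal (Real.exp (p.2 * c p.1 - c p.1 ^ 2 / 2)) := by fun_prop
  have hprod := (indepFun_iff_map_prod_eq_prod_map_map hZ.aemeasurable hη.aemeasurable).1 hind.symm
  calc ∫⁻ ω, W (Z ω) * ENNReal.ofReal (Real.exp (η ω * c (Z ω) - c (Z ω) ^ 2 / 2)) ∂P
      = ∫⁻ p, W p.1 * ENNReal.ofReal (Real.exp (p.2 * c p.1 - c p.1 ^ 2 / 2))
          ∂(P.map fun ω => (Z ω, η ω)) := by
        rw [lintegral_map hF (hZ.prodMk hη)]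
    _ = ∫⁻ z, ∫⁻ y, W z * ENNReal.ofReal (Real.exp (y * c z - c z ^ 2 / 2)) ∂(P.map η)
          ∂(P.map Z) := by
        rw [hprod, lintegral_prod _ hF.aemeasurable]
    _ ≤ ∫⁻ z, W z ∂(P.map Z) := by
        refine lintegral_mono fun z => ?_
        rw [lintegral_const_mul _ (by fun_prop), lintegral_map (by fun_prop) hη]
        have h1 : ∫⁻ ω, ENNReal.ofReal (Real.exp (η ω * c z - c z ^ 2 / 2)) ∂P ≤ 1 := by
          have hint := (hsub.integrable_exp_mul (c z)).mul_const (Real.exp (-(c z ^ 2 / 2)))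
          have heq : ∀ ω, Real.exp (η ω * c z - c z ^ 2 / 2) =
              Real.exp (c z * η ω) * Real.exp (-(c z ^ 2 / 2)) := by
            intro ω
            rw [← Real.exp_add]
            congr 1
            ring
          simp only [heq]
          rw [← ofReal_integral_eq_lintegral_ofReal hint
            (Filter.Eventually.of_forall fun ω => by positivity), ENNReal.ofReal_le_one,
            integral_mul_const]
          have := hsub.mgf_le (c z)
          simp only [mgf, NNReal.coe_one, one_mul] at this
          calc _ ≤ Real.exp (c z ^ 2 / 2) * Real.exp (-(c z ^ 2 / 2)) :=
                mul_le_mul_of_nonneg_right this (Real.exp_pos _).le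
            _ = 1 := by rw [← Real.exp_add]; simp
        calc _ ≤ W z * 1 := by gcongr
          _ = W z := mul_one _
    _ = ∫⁻ ω, W (Z ω) ∂P := lintegral_map hW hZ

/-- The exponential supermartingale in a fixed direction `u`. -/
lemma lintegral_exp_sum_le_one (hx : ∀ s < t, Measurable (x s)) (he : ∀ s < t, Measurable (e s))
    (hsub : ∀ s < t, HasSubgaussianMGF (e s) 1 P)
    (hind : ∀ s < t, IndepFun (e s) (fun ω => ((fun r : Fin s => (x r ω, e r ω)), x s ω)) P)
    (u : n → ℝ) :
    ∫⁻ ω, ENNReal.ofReal (Real.exp (∑ s ∈ Finset.range t,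
      (e s ω * (u ⬝ᵥ x s ω) - (u ⬝ᵥ x s ω) ^ 2 / 2))) ∂P ≤ 1 := by
  induction t with
  | zero => simp
  | succ t ih =>
    refine le_trans ?_ (ih (fun s hs => hx s (by omega)) (fun s hs => he s (by omega))
      (fun s hs => hsub s (by omega)) fun s hs => hind s (by omega))
    have hdot : Measurable fun y : n → ℝ => u ⬝ᵥ y := by
      simp only [dotProduct]; fun_prop
    have hZ : Measurable fun ω => ((fun r : Fin t => (x r ω, e r ω)), x t ω) :=
      (measurable_pi_lambda _ fun r : Fin t => (hx r (by omega)).prodMk (he r (by omega))).prodMk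
        (hx t (by omega))
    have hW : Measurable fun z : (Fin t → (n → ℝ) × ℝ) × (n → ℝ) =>
        ENNReal.ofReal (Real.exp (∑ r : Fin t,
          ((z.1 r).2 * (u ⬝ᵥ (z.1 r).1) - (u ⬝ᵥ (z.1 r).1) ^ 2 / 2))) := by
      fun_prop
    have h := lintegral_mul_exp_le hZ (he t (by omega)) (hind t (by omega)) (hsub t (by omega)) hW
      (c := fun z => u ⬝ᵥ z.2) (hdot.comp measurable_snd)
    have hsum : ∀ ω, ∑ s ∈ Finset.range t, (e s ω * (u ⬝ᵥ x s ω) - (u ⬝ᵥ x s ω) ^ 2 / 2) =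
        ∑ r : Fin t, (e r ω * (u ⬝ᵥ x r ω) - (u ⬝ᵥ x r ω) ^ 2 / 2) := fun ω =>
      Finset.sum_range fun s => (e s ω * (u ⬝ᵥ x s ω) - (u ⬝ᵥ x s ω) ^ 2 / 2)
    simp only [Finset.sum_range_succ, hsum, Real.exp_add, ENNReal.ofReal_mul (Real.exp_pos _).le]
    exact h

end Supermartingale

/-! ### The method of mixtures and self-normalized concentration. -/

section Mixtures

open Matrix

variable {n : Type*} [Fintype n] [DecidableEq n]

lemma measurable_det {Ω : Type*} [MeasurableSpace Ω] {A : Ω → Matrix n n ℝ}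
    (hA : ∀ i j, Measurable fun ω => A ω i j) : Measurable fun ω => (A ω).det := by
  simp only [det_apply']
  exact Finset.measurable_sum _ fun σ _ =>
    (Finset.measurable_prod _ fun i _ => hA (σ i) i).const_mul _

lemma measurable_inv_apply {Ω : Type*} [MeasurableSpace Ω] {A : Ω → Matrix n n ℝ}
    (hA : ∀ i j, Measurable fun ω => A ω i j) (i j : n) : Measurable fun ω => (A ω)⁻¹ i j := by
  simp only [Matrix.inv_def, Ring.inverse_eq_inv', Matrix.smul_apply, smul_eq_mul, adjugate_apply]
  refine (measurable_det hA).inv.mul (measurable_det fun k l => ?_)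
  simp only [updateRow_apply]
  split_ifs
  · exact measurable_const
  · exact hA k l

variable {Ω : Type*} [MeasurableSpace Ω] {P : Measure Ω}
  {x : ℕ → Ω → n → ℝ} {e : ℕ → Ω → ℝ} {lam : ℝ} {t : ℕ}

lemma measurable_gram_inv_apply (hx : ∀ s < t, Measurable (x s)) (i j : n) :
    Measurable fun ω => (gram lam (fun s => x s ω) t)⁻¹ i j := by
  refine measurable_inv_apply (fun i j => ?_) i j
  simp only [gram, Matrix.add_apply, Matrix.sum_apply, vecMulVec_apply]
  refine measurable_const.add (Finset.measurable_sum _ fun s hs => ?_)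
  have := hx s (Finset.mem_range.1 hs)
  exact ((measurable_pi_apply i).comp this).mul ((measurable_pi_apply j).comp this)

lemma measurable_logDet (hx : ∀ s < t, Measurable (x s)) :
    Measurable fun ω => logDet lam (fun s => x s ω) t := by
  refine Real.measurable_log.comp (Measurable.div_const (measurable_det fun i j => ?_) _)
  simp only [gram, Matrix.add_apply, Matrix.sum_apply, vecMulVec_apply]
  refine measurable_const.add (Finset.measurable_sum _ fun s hs => ?_)
  have := hx s (Finset.mem_range.1 hs)
  exact ((measurable_pi_apply i).comp this).mul ((measurable_pi_apply j).comp this)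

lemma measurable_dotProduct_gram_inv (hx : ∀ s < t, Measurable (x s)) {y z : Ω → n → ℝ}
    (hy : Measurable y) (hz : Measurable z) :
    Measurable fun ω => y ω ⬝ᵥ (gram lam (fun s => x s ω) t)⁻¹ *ᵥ z ω := by
  have h := measurable_gram_inv_apply (lam := lam) hx
  simp only [dotProduct, mulVec]
  exact Finset.measurable_sum _ fun i _ => ((measurable_pi_apply i).comp hy).mul
    (Finset.measurable_sum _ fun j _ => (h i j).mul ((measurable_pi_apply j).comp hz))

variable [IsProbabilityMeasure P]

/-- The method of mixtures with a Gaussian prior. -/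
lemma lintegral_exp_invForm_le_one (hlam : 0 < lam) (hx : ∀ s < t, Measurable (x s))
    (he : ∀ s < t, Measurable (e s)) (hsub : ∀ s < t, HasSubgaussianMGF (e s) 1 P)
    (hind : ∀ s < t, IndepFun (e s) (fun ω => ((fun r : Fin s => (x r ω, e r ω)), x s ω)) P) :
    ∫⁻ ω, ENNReal.ofReal (Real.exp ((invForm (gram lam (fun s => x s ω) t)
        (∑ s ∈ Finset.range t, e s ω • x s ω) - logDet lam (fun s => x s ω) t) / 2)) ∂P ≤ 1 := by
  set S : Ω → n → ℝ := fun ω => ∑ s ∈ Finset.range t, e s ω • x s ω with hS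
  set V : Ω → Matrix n n ℝ := fun ω => gram lam (fun s => x s ω) t with hV
  -- The total mass of the unnormalized Gaussian prior `exp (-lam ‖u‖² / 2)`; see `hprior`.
  let C : ℝ := √(2 * Real.pi) ^ Fintype.card n * (√(lam ^ Fintype.card n))⁻¹
  have hlamn := pow_pos hlam (Fintype.card n)
  have hC : 0 < C := by
    have := Real.pi_pos
    positivity
  have hg : ∀ ω, ENNReal.ofReal C * ENNReal.ofReal (Real.exp ((invForm (V ω) (S ω) -
      logDet lam (fun s => x s ω) t) / 2)) =
      ∫⁻ u : n → ℝ, ENNReal.ofReal (Real.exp (u ⬝ᵥ S ω - (u ⬝ᵥ V ω *ᵥ u) / 2)) := by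
    intro ω
    have hA : (V ω).PosDef := gram_posDef hlam t
    have hd := hA.det_pos
    rw [lintegral_gaussian hA, ← ENNReal.ofReal_mul hC.le]
    congr 1
    rw [sub_div, Real.exp_sub, Real.exp_half (logDet lam _ t), logDet, Real.exp_log (by positivity),
      Real.sqrt_div' _ hlamn.le]
    simp only [C]
    have h1 := (Real.sqrt_pos.2 hlamn).ne'
    have h2 := (Real.sqrt_pos.2 hd).ne'
    simp only [hV] at h2 ⊢
    field_simp
  have hexp : ∀ (u : n → ℝ) ω, u ⬝ᵥ S ω - (u ⬝ᵥ V ω *ᵥ u) / 2 =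
      -(u ⬝ᵥ (lam • (1 : Matrix n n ℝ)) *ᵥ u) / 2 +
      ∑ s ∈ Finset.range t, (e s ω * (u ⬝ᵥ x s ω) - (u ⬝ᵥ x s ω) ^ 2 / 2) := by
    intro u ω
    simp only [hS, hV, gram_quadratic, dotProduct_sum, dotProduct_smul, smul_eq_mul,
      Finset.sum_sub_distrib, Finset.sum_div, smul_mulVec, one_mulVec, add_div]
    ring
  have hxm : ∀ s < t, Measurable fun p : Ω × (n → ℝ) => p.2 ⬝ᵥ x s p.1 := fun s hs => by
    have := hx s hs
    simp only [dotProduct]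
    fun_prop
  have hmeas : Measurable fun p : Ω × (n → ℝ) =>
      ENNReal.ofReal (Real.exp (p.2 ⬝ᵥ S p.1 - (p.2 ⬝ᵥ V p.1 *ᵥ p.2) / 2)) := by
    simp only [hexp]
    refine (Real.measurable_exp.comp (Measurable.add ?_
      (Finset.measurable_sum _ fun s hs => ?_))).ennreal_ofReal
    · simp only [dotProduct, mulVec]; fun_prop
    · have h1 := hxm s (Finset.mem_range.1 hs)
      have h2 := he s (Finset.mem_range.1 hs)
      exact ((h2.comp measurable_fst).mul h1).sub ((h1.pow_const 2).div_const 2)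
  have hprior : ∫⁻ u : n → ℝ,
      ENNReal.ofReal (Real.exp (-(u ⬝ᵥ (lam • (1 : Matrix n n ℝ)) *ᵥ u) / 2)) =
      ENNReal.ofReal C := by
    have h := lintegral_gaussian (PosDef.one.smul hlam : (lam • (1 : Matrix n n ℝ)).PosDef) 0
    simp only [dotProduct_zero, zero_sub, invForm, mulVec_zero, zero_div, Real.exp_zero, mul_one,
      det_smul, det_one, ← neg_div] at h
    exact h
  -- By Tonelli the expectation is taken first; each direction `u` then contributes at most its
  -- prior weight.
  have hkey : ENNReal.ofReal C * ∫⁻ ω, ENNReal.ofReal (Real.exp ((invForm (V ω) (S ω) -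
      logDet lam (fun s => x s ω) t) / 2)) ∂P ≤ ENNReal.ofReal C := by
    rw [← lintegral_const_mul' _ _ ENNReal.ofReal_ne_top]
    simp only [hg]
    rw [lintegral_lintegral_swap hmeas.aemeasurable, ← hprior]
    refine lintegral_mono fun u => ?_
    simp only [hexp, Real.exp_add, ENNReal.ofReal_mul (Real.exp_pos _).le]
    rw [lintegral_const_mul' _ _ ENNReal.ofReal_ne_top]
    exact mul_le_of_le_one_right' (lintegral_exp_sum_le_one hx he hsub hind u)
  have hC0 : ENNReal.ofReal C ≠ 0 := by simpa using hC
  exact (ENNReal.mul_le_mul_iff_right hC0 ENNReal.ofReal_ne_top).1 (by rwa [mul_one])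

/-- The confidence bound for self-normalized sums at a fixed time. -/
lemma measure_invForm_ge_le (hlam : 0 < lam) (hx : ∀ s < t, Measurable (x s))
    (he : ∀ s < t, Measurable (e s)) (hsub : ∀ s < t, HasSubgaussianMGF (e s) 1 P)
    (hind : ∀ s < t, IndepFun (e s) (fun ω => ((fun r : Fin s => (x r ω, e r ω)), x s ω)) P)
    (b : ℝ) :
    P {ω | b + logDet lam (fun s => x s ω) t < invForm (gram lam (fun s => x s ω) t)
        (∑ s ∈ Finset.range t, e s ω • x s ω)} ≤ ENNReal.ofReal (Real.exp (-(b / 2))) := by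
  have h := lintegral_exp_invForm_le_one hlam hx he hsub hind
  set F := fun ω => (invForm (gram lam (fun s => x s ω) t)
        (∑ s ∈ Finset.range t, e s ω • x s ω) - logDet lam (fun s => x s ω) t) / 2 with hF
  have hS : Measurable fun ω => ∑ s ∈ Finset.range t, e s ω • x s ω :=
    Finset.measurable_sum _ fun s hs =>
      (he s (Finset.mem_range.1 hs)).smul (hx s (Finset.mem_range.1 hs))
  have hFm : Measurable F :=
    ((measurable_dotProduct_gram_inv hx hS hS).sub (measurable_logDet hx)).div_const 2
  have hb : ENNReal.ofReal (Real.exp (b / 2)) ≠ 0 := by simpa using Real.exp_pos _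
  have h1 : ENNReal.ofReal (Real.exp (b / 2)) *
      P {ω | ENNReal.ofReal (Real.exp (b / 2)) ≤ ENNReal.ofReal (Real.exp (F ω))} ≤ 1 :=
    (mul_meas_ge_le_lintegral₀ hFm.exp.ennreal_ofReal.aemeasurable _).trans h
  have h2 : P {ω | b + logDet lam (fun s => x s ω) t < invForm (gram lam (fun s => x s ω) t)
        (∑ s ∈ Finset.range t, e s ω • x s ω)} ≤
      P {ω | ENNReal.ofReal (Real.exp (b / 2)) ≤ ENNReal.ofReal (Real.exp (F ω))} := by
    refine measure_mono fun ω hω => ENNReal.ofReal_le_ofReal (Real.exp_le_exp.2 ?_)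
    simp only [Set.mem_ofPred_eq] at hω
    simp only [hF]
    linarith
  rw [Real.exp_neg, ENNReal.ofReal_inv_of_pos (Real.exp_pos _)]
  refine h2.trans ?_
  rw [← ENNReal.mul_le_mul_iff_right hb ENNReal.ofReal_ne_top,
    ENNReal.mul_inv_cancel hb ENNReal.ofReal_ne_top]
  exact h1

end Mixtures

/-! ### Longest paths are optimal lists. -/

section LongestPath

variable {d L K : ℕ} {M : Model d L K} {ϑ : Params d L} {p : Fin L → Node L K}

/-- The layer grows by one along each edge, and `L` vertices must fit into `L` layers, so the path
has to start in the first one. -/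
lemma IsPath.layer_eq (hp : IsPath p) (l : Fin L) : (p l).layer = l := by
  have h0 : 0 < L := l.pos
  have hlin : ∀ k (hk : k < L), (p ⟨k, hk⟩).layer.val = (p ⟨0, h0⟩).layer.val + k := by
    intro k
    induction k with
    | zero => intro hk; rfl
    | succ k ih =>
      intro hk
      have h := (hp ⟨k, by omega⟩ hk).1
      have h2 := ih (by omega)
      simp only at h
      omega
  have hlast := hlin (L - 1) (by omega)
  have hlt := (p ⟨L - 1, by omega⟩).layer.isLt
  have hl := hlin l l.isLt
  ext
  simp only [Fin.eta] at hl
  omega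

lemma IsPath.prev_eq (hp : IsPath p) (l : Fin L) : (p l).prev = prevItem (pathAction p) l := by
  rcases Nat.eq_zero_or_pos l.val with h0 | h0
  · rw [prevItem, if_pos h0, (p l).prev_eq_none_iff, hp.layer_eq, h0]
  · have hlt := l.isLt
    have h := (hp ⟨l.val - 1, by omega⟩ (by simp only; omega)).2
    have hl : (⟨l.val - 1 + 1, by omega⟩ : Fin L) = l := Fin.ext (by simp only; omega)
    simp only [hl] at h
    rw [prevItem, if_neg (by omega), h]
    rfl

lemma IsPath.nodeReward_eq (hp : IsPath p) (l : Fin L) :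
    M.nodeReward ϑ (p l) = inner ℝ (ϑ l) (M.actionFeature (pathAction p) l) := by
  rw [Model.nodeReward, Model.actionFeature, hp.prev_eq, hp.layer_eq]
  rfl

/-- In a path the weights of the edges sum up to the rewards of the vertices. -/
lemma sum_edges_eq_sum {m : ℕ} (f : Fin (m + 2) → ℝ) :
    ∑ i : Fin (m + 1), (1 / 2 : ℝ) * ((if i.val = 0 then 2 else 1) * f i.castSucc +
      (if i.val + 1 + 1 = m + 2 then 2 else 1) * f i.succ) = ∑ i, f i := by
  have h1 : ∑ i : Fin (m + 1), (if i.val = 0 then (2 : ℝ) else 1) * f i.castSucc =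
      ∑ i : Fin (m + 1), f i.castSucc + f 0 := by
    rw [Fin.sum_univ_succ, Fin.sum_univ_succ (fun i : Fin (m + 1) => f i.castSucc)]
    simp
    ring
  have h2 : ∑ i : Fin (m + 1), (if i.val + 1 + 1 = m + 2 then (2 : ℝ) else 1) * f i.succ =
      ∑ i : Fin (m + 1), f i.succ + f (Fin.last _) := by
    rw [Fin.sum_univ_castSucc, Fin.sum_univ_castSucc (fun i : Fin (m + 1) => f i.succ)]
    have : ∀ i : Fin m, ¬ (i.val = m) := fun i => i.isLt.ne
    simp [this]
    ring
  -- Inner vertices occur in both sums, and the doubled ends supply the second copies of `f 0` and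
  -- of the last value.
  rw [← Finset.mul_sum, Finset.sum_add_distrib, h1, h2]
  have h3 := Fin.sum_univ_succ f
  have h4 := Fin.sum_univ_castSucc f
  linarith

lemma IsPath.pathWeight_eq (hp : IsPath p) :
    M.pathWeight ϑ p = M.meanReward ϑ (pathAction p) := by
  have hsum : M.meanReward ϑ (pathAction p) = ∑ l, M.nodeReward ϑ (p l) :=
    Finset.sum_congr rfl fun l _ => (hp.nodeReward_eq l).symm
  rw [hsum, Model.pathWeight]
  match L, M, ϑ, p, hp with
  | 0, _, _, _, _ => simp
  | 1, _, _, _, _ => simp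
  | m + 2, M, ϑ, p, hp =>
    rw [if_neg (by omega), ← sum_edges_eq_sum (fun l => M.nodeReward ϑ (p l)),
      Fin.sum_univ_castSucc]
    have hlast : ¬ ((Fin.last (m + 1)).val + 1 < m + 2) := by simp
    rw [dif_neg hlast, add_zero]
    refine Finset.sum_congr rfl fun i _ => ?_
    rw [dif_pos (by simp; omega), Model.edgeWeight, hp.layer_eq, hp.layer_eq]
    rfl

/-- The vertex of position `l` on the path of a list. -/
def actionNode (a : Action L K) (l : Fin L) : Node L K where
  layer := l
  prev := prevItem a l
  cur := a l
  prev_eq_none_iff := by simp [prevItem]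

lemma isPath_actionNode (a : Action L K) : IsPath (actionNode a) := by
  intro l h
  refine ⟨rfl, ?_⟩
  simp [actionNode, prevItem]

lemma pathAction_actionNode (a : Action L K) : pathAction (actionNode a) = a := rfl

lemma Model.IsLongestPath.meanReward_le (hp : M.IsLongestPath ϑ p) (a : Action L K) :
    M.meanReward ϑ a ≤ M.meanReward ϑ (pathAction p) := by
  have h := hp.2 _ (isPath_actionNode a)
  rwa [(isPath_actionNode a).pathWeight_eq, hp.1.pathWeight_eq, pathAction_actionNode] at h

end LongestPath

/-! ### Optimality, feature norms and almost sure bounds from the prior. -/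

section Bounds

variable {Ω : Type*} [MeasurableSpace Ω] {d L K : ℕ} {M : Model d L K}
  {Q : Fin L → Measure (EuclideanSpace ℝ (Fin d))} {T : ℕ} {P : Measure Ω}
  [IsProbabilityMeasure P] (R : RankTSRun M Q T P)

/-- Running the path algorithm on the true parameters gives an optimal list, so the optimum is the
same function of `θ` as the played list is of `θhat`. -/
lemma RankTSRun.iSup_meanReward (ϑ : Params d L) :
    ⨆ a : Action L K, M.meanReward ϑ a = M.meanReward ϑ (R.best ϑ) := by
  have : Nonempty (Action L K) := ⟨R.best ϑ⟩
  refine le_antisymm (ciSup_le (R.solver_longest ϑ).meanReward_le) ?_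
  exact le_ciSup (Set.finite_range _).bddAbove (R.best ϑ)

lemma Model.norm_actionFeature_le {m₁ : ℝ} (hm₁ : 0 < m₁) (hv : ∀ i, ‖M.v i‖ ≤ m₁)
    (hv₀ : (∀ l : Fin L, l.val = 0 → M.w l = 0) ∨ ‖M.v₀‖ ≤ m₁) (a : Action L K) (l : Fin L) :
    ‖M.actionFeature a l‖ ≤ (1 + ⨆ l, |M.w l|) * m₁ := by
  have hw : |M.w l| ≤ ⨆ l, |M.w l| := le_ciSup (f := fun l => |M.w l|)
    (Set.finite_range _).bddAbove l
  have hprev : ‖M.w l • (prevItem a l).elim M.v₀ M.v‖ ≤ |M.w l| * m₁ := by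
    rw [norm_smul, Real.norm_eq_abs]
    by_cases h : l.val = 0
    · rcases hv₀ with hv₀ | hv₀
      · simp [hv₀ l h]
      · simp only [prevItem, if_pos h, Option.elim_none]
        gcongr
    · simp only [prevItem, if_neg h, Option.elim_some]
      gcongr
      exact hv _
  calc _ ≤ ‖M.v (a l)‖ + ‖M.w l • (prevItem a l).elim M.v₀ M.v‖ := norm_add_le _ _
    _ ≤ m₁ + |M.w l| * m₁ := add_le_add (hv _) hprev
    _ ≤ (1 + ⨆ l, |M.w l|) * m₁ := by nlinarith

variable [∀ l, IsProbabilityMeasure (Q l)]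

lemma RankTSRun.ae_of_prior (l : Fin L) {p : EuclideanSpace ℝ (Fin d) → Prop}
    (h : ∀ᵐ ϑ ∂(Q l), p ϑ) : ∀ᵐ ω ∂P, p (R.θ ω l) := by
  have h1 : MeasurePreserving R.θ P (Measure.pi Q) := ⟨R.measurable_θ, R.law_θ⟩
  exact ((measurePreserving_eval Q l).comp h1).quasiMeasurePreserving.ae h

lemma RankTSRun.ae_norm_θ_le {m₂ : ℝ} (hQ : ∀ l, ∀ᵐ ϑ ∂(Q l), ‖ϑ‖ ≤ m₂) :
    ∀ᵐ ω ∂P, ∀ l, ‖R.θ ω l‖ ≤ m₂ :=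
  ae_all_iff.2 fun l => R.ae_of_prior l (hQ l)

lemma RankTSRun.ae_abs_inner_le (hreward : ∀ u : Node L K, ∀ᵐ ϑ ∂(Q u.layer),
      |inner ℝ ϑ (M.feature u.layer u.prev u.cur)| ≤ 1) :
    ∀ᵐ ω ∂P, ∀ l a, |inner ℝ (R.θ ω l) (M.actionFeature a l)| ≤ 1 :=
  ae_all_iff.2 fun l => ae_all_iff.2 fun a => R.ae_of_prior l (hreward (actionNode a l))

end Bounds

/-! ### Confidence indices and their widths. -/

section Regret

open WithLp Matrix

variable {Ω : Type*} [MeasurableSpace Ω] {d L K : ℕ} {M : Model d L K}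
  {Q : Fin L → Measure (EuclideanSpace ℝ (Fin d))} {T : ℕ} {P : Measure Ω}
  [IsProbabilityMeasure P] (R : RankTSRun M Q T P)

lemma inner_eq_dotProduct (x y : EuclideanSpace ℝ (Fin d)) :
    inner ℝ x y = ofLp x ⬝ᵥ ofLp y := by
  rw [EuclideanSpace.inner_eq_star_dotProduct, star_trivial, dotProduct_comm]

/-- The coordinates of the feature of position `l` of a list. -/
def Model.featureVec (M : Model d L K) (l : Fin L) (a : Action L K) : Fin d → ℝ :=
  ofLp (M.actionFeature a l)

lemma Model.measurable_featureVec (M : Model d L K) (l : Fin L) : Measurable (M.featureVec l) :=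
  measurable_of_countable _

lemma Model.inner_actionFeature (M : Model d L K) (θ : EuclideanSpace ℝ (Fin d)) (a : Action L K)
    (l : Fin L) : inner ℝ θ (M.actionFeature a l) = ofLp θ ⬝ᵥ M.featureVec l a :=
  inner_eq_dotProduct _ _

lemma RankTSRun.measurable_featureVec (l : Fin L) {t : ℕ} (ht : t < T) :
    Measurable fun ω => M.featureVec l (R.a t ω) :=
  (M.measurable_featureVec l).comp (R.measurable_a ht)

/-- `noise_fresh` does not mention earlier noise, but that noise is recovered from `θ` and the
history as reward minus mean. -/
lemma RankTSRun.indepFun_noise (l : Fin L) {t : ℕ} (ht : t < T) :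
    IndepFun (R.η t l) (fun ω => ((fun r : Fin t => (M.featureVec l (R.a r ω), R.η r l ω)),
      M.featureVec l (R.a t ω))) P := by
  have hm : Measurable fun q : Params d L × (Fin t → Action L K × (Fin L → ℝ)) × Params d L =>
      ((fun r : Fin t => (M.featureVec l (q.2.1 r).1,
        (q.2.1 r).2 l - inner ℝ (q.1 l) (M.actionFeature (q.2.1 r).1 l))),
        M.featureVec l (R.best q.2.2)) := by
    have h1 : ∀ r : Fin t, Measurable fun q : Params d L × (Fin t → Action L K × (Fin L → ℝ)) ×
        Params d L => (q.2.1 r).1 := fun r => by fun_prop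
    refine Measurable.prodMk (measurable_pi_lambda _ fun r => Measurable.prodMk
      ((M.measurable_featureVec l).comp (h1 r)) (Measurable.sub (by fun_prop) (Measurable.inner
        (by fun_prop) ((M.measurable_actionFeature l).comp (h1 r)))))
      ((M.measurable_featureVec l).comp (R.measurable_best.comp measurable_snd.snd))
  have h := (R.noise_fresh t ht).comp (measurable_pi_apply l) hm
  refine h.congr (Filter.EventuallyEq.refl _ _) (Filter.Eventually.of_forall fun ω => ?_)
  refine Prod.ext (funext fun r => Prod.ext rfl ?_) ?_
  · change R.r r l ω - inner ℝ (R.θ ω l) (M.actionFeature (R.a r ω) l) = R.η r l ω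
    rw [R.reward_eq r (r.2.trans ht)]
    ring
  · change M.featureVec l (R.best (R.θhat t ω)) = M.featureVec l (R.a t ω)
    rw [R.a_eq ht]

/-- The Gram matrix of position `l` before round `t`. -/
def RankTSRun.V (lam : ℝ) (l : Fin L) (t : ℕ) (ω : Ω) : Matrix (Fin d) (Fin d) ℝ :=
  gram lam (fun s => M.featureVec l (R.a s ω)) t

/-- The event that the noise of position `l` before round `t` is large. -/
def RankTSRun.badEvent (lam : ℝ) (l : Fin L) (t : ℕ) : Set Ω :=
  {ω | 4 * Real.log T + logDet lam (fun s => M.featureVec l (R.a s ω)) t <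
    invForm (R.V lam l t ω) (∑ s ∈ Finset.range t, R.η s l ω • M.featureVec l (R.a s ω))}

lemma RankTSRun.measurableSet_badEvent (lam : ℝ) (l : Fin L) {t : ℕ} (ht : t ≤ T) :
    MeasurableSet (R.badEvent lam l t) := by
  have hx : ∀ s < t, Measurable fun ω => M.featureVec l (R.a s ω) := fun s hs =>
    R.measurable_featureVec l (hs.trans_le ht)
  have hS : Measurable fun ω => ∑ s ∈ Finset.range t, R.η s l ω • M.featureVec l (R.a s ω) :=
    Finset.measurable_sum _ fun s hs => (R.measurable_η s
      ((Finset.mem_range.1 hs).trans_le ht) l).smul (hx s (Finset.mem_range.1 hs))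
  exact measurableSet_lt (measurable_const.add (measurable_logDet hx))
    (measurable_dotProduct_gram_inv hx hS hS)

/-- The level `4 log T` turns `exp (-b / 2)` into `T⁻²`. A bound at each fixed time suffices, since
the bad events enter the regret only through the sum of their probabilities. -/
lemma RankTSRun.measureReal_badEvent_le {lam : ℝ} (hlam : 0 < lam) (l : Fin L) {t : ℕ}
    (ht : t < T) : P.real (R.badEvent lam l t) ≤ 1 / (T : ℝ) ^ 2 := by
  have h := measure_invForm_ge_le (P := P) (lam := lam) (t := t)
    (x := fun s ω => M.featureVec l (R.a s ω)) (e := fun s => R.η s l) hlam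
    (fun s hs => R.measurable_featureVec l (hs.trans ht))
    (fun s hs => R.measurable_η s (hs.trans ht) l)
    (fun s hs => R.noise_subgaussian s (hs.trans ht) l)
    (fun s hs => R.indepFun_noise l (hs.trans ht)) (4 * Real.log T)
  have hT : (0 : ℝ) < T := by exact_mod_cast (Nat.zero_le t).trans_lt ht
  have he : Real.exp (-(4 * Real.log T / 2)) = 1 / (T : ℝ) ^ 2 := by
    have : -(4 * Real.log T / 2) = -(Real.log T + Real.log T) := by ring
    rw [this, Real.exp_neg, Real.exp_add, Real.exp_log hT, one_div, sq]
  rw [he] at h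
  exact ENNReal.toReal_le_of_le_ofReal (by positivity) h

/-- The optimistic index of a list at position `l`, clipped to `[-1, 1]`, as a function of the
history and the list. -/
def Model.ucb (M : Model d L K) (lam β : ℝ) (l : Fin L) (t : ℕ)
    (q : (Fin t → Action L K × (Fin L → ℝ)) × Action L K) : ℝ :=
  max (-1) (min 1 (
    M.featureVec l q.2 ⬝ᵥ
      -- The value `0` for `s ≥ t` plays no role, as the Gram matrix at `t` only sums over `s < t`.
      (gram lam (fun s => if hs : s < t then M.featureVec l (q.1 ⟨s, hs⟩).1 else 0) t)⁻¹ *ᵥ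
      (∑ s : Fin t, (q.1 s).2 l • M.featureVec l (q.1 s).1) +
    β * √(invForm (gram lam
      (fun s => if hs : s < t then M.featureVec l (q.1 ⟨s, hs⟩).1 else 0) t)
        (M.featureVec l q.2))))

lemma Model.measurable_ucb (M : Model d L K) (lam β : ℝ) (l : Fin L) (t : ℕ) :
    Measurable (M.ucb lam β l t) := by
  have h1 : ∀ r : Fin t, Measurable fun q : (Fin t → Action L K × (Fin L → ℝ)) × Action L K =>
      M.featureVec l (q.1 r).1 := fun r => (M.measurable_featureVec l).comp (by fun_prop)
  have hx : ∀ s < t, Measurable fun q : (Fin t → Action L K × (Fin L → ℝ)) × Action L K =>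
      if hs : s < t then M.featureVec l (q.1 ⟨s, hs⟩).1 else 0 := fun s hs => by
    simp only [dif_pos hs]
    exact h1 ⟨s, hs⟩
  have hy : Measurable fun q : (Fin t → Action L K × (Fin L → ℝ)) × Action L K =>
      M.featureVec l q.2 := (M.measurable_featureVec l).comp measurable_snd
  have hb : Measurable fun q : (Fin t → Action L K × (Fin L → ℝ)) × Action L K =>
      ∑ s : Fin t, (q.1 s).2 l • M.featureVec l (q.1 s).1 :=
    Finset.measurable_sum _ fun s _ => Measurable.smul
      ((measurable_pi_apply l).comp ((measurable_pi_apply s).comp measurable_fst).snd) (h1 s)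
  exact measurable_const.max (measurable_const.min
    ((measurable_dotProduct_gram_inv hx hy hb).add
      ((measurable_dotProduct_gram_inv hx hy hy).sqrt.const_mul β)))

/-- Clipping makes the index integrable and caps the loss on the bad event; optimism survives
because the true means lie in `[-1, 1]`. -/
lemma Model.abs_ucb_le (M : Model d L K) (lam β : ℝ) (l : Fin L) (t : ℕ)
    (q : (Fin t → Action L K × (Fin L → ℝ)) × Action L K) : |M.ucb lam β l t q| ≤ 1 := by
  rw [abs_le]
  exact ⟨le_max_left _ _, max_le (by norm_num) (min_le_left _ _)⟩

lemma RankTSRun.ucb_eq (lam β : ℝ) (l : Fin L) {t : ℕ} (ht : t ≤ T) (ω : Ω) (a : Action L K) :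
    M.ucb lam β l t (R.H t ω, a) = max (-1) (min 1 (
      M.featureVec l a ⬝ᵥ (R.V lam l t ω)⁻¹ *ᵥ (∑ s ∈ Finset.range t,
        (ofLp (R.θ ω l) ⬝ᵥ M.featureVec l (R.a s ω) + R.η s l ω) • M.featureVec l (R.a s ω)) +
      β * √(invForm (R.V lam l t ω) (M.featureVec l a)))) := by
  have hV : gram lam (fun s => if hs : s < t then M.featureVec l (R.H t ω ⟨s, hs⟩).1 else 0) t =
      R.V lam l t ω := by
    rw [RankTSRun.V, gram, gram]
    congr 1
    refine Finset.sum_congr rfl fun s hs => ?_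
    rw [dif_pos (Finset.mem_range.1 hs)]
    rfl
  rw [Model.ucb, hV, Finset.sum_range]
  congr 5
  refine Finset.sum_congr rfl fun s _ => ?_
  rw [← Model.inner_actionFeature, ← R.reward_eq s (s.2.trans_le ht)]
  rfl

variable {m₁ m₂ lam : ℝ}

/-- Outside the bad event the index is optimistic and close to the true mean. -/
lemma RankTSRun.ucb_bounds (hm₂ : 0 < m₂) (hlam : lam = 1 / m₂ ^ 2) {β : ℝ} (l : Fin L) {t : ℕ}
    (ht : t ≤ T) {ω : Ω} (hω : ω ∉ R.badEvent lam l t)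
    (hβ : 1 + √(4 * Real.log T + logDet lam (fun s => M.featureVec l (R.a s ω)) t) ≤ β)
    (hθ : ‖R.θ ω l‖ ≤ m₂) (a : Action L K)
    (hr : |inner ℝ (R.θ ω l) (M.actionFeature a l)| ≤ 1) :
    inner ℝ (R.θ ω l) (M.actionFeature a l) ≤ M.ucb lam β l t (R.H t ω, a) ∧
      M.ucb lam β l t (R.H t ω, a) - inner ℝ (R.θ ω l) (M.actionFeature a l) ≤
        2 * β * √(min 1 (invForm (R.V lam l t ω) (M.featureVec l a))) := by
  have hlam0 : 0 < lam := by rw [hlam]; positivity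
  have hθ' : lam * (ofLp (R.θ ω l) ⬝ᵥ ofLp (R.θ ω l)) ≤ 1 := by
    rw [← inner_eq_dotProduct, real_inner_self_eq_norm_sq, hlam, one_div,
      inv_mul_le_iff₀ (by positivity), mul_one]
    gcongr
  have hdev := abs_dotProduct_leastSquares_sub_le (x := fun s => M.featureVec l (R.a s ω)) hlam0 t
    (ofLp (R.θ ω l)) (fun s => R.η s l ω) hθ' (M.featureVec l a)
  rw [R.ucb_eq lam β l ht]
  change |_ ⬝ᵥ (R.V lam l t ω)⁻¹ *ᵥ _ - _| ≤ √(invForm (R.V lam l t ω) _) *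
    (1 + √(invForm (R.V lam l t ω) _)) at hdev
  rw [dotProduct_comm _ (ofLp (R.θ ω l)), ← Model.inner_actionFeature] at hdev
  set q := invForm (R.V lam l t ω) (M.featureVec l a)
  set y := M.featureVec l a ⬝ᵥ (R.V lam l t ω)⁻¹ *ᵥ (∑ s ∈ Finset.range t,
        (ofLp (R.θ ω l) ⬝ᵥ M.featureVec l (R.a s ω) + R.η s l ω) • M.featureVec l (R.a s ω))
  set μ := inner ℝ (R.θ ω l) (M.actionFeature a l)
  have hq : 0 ≤ √q := Real.sqrt_nonneg q
  have hβ1 : 1 ≤ β := le_trans (by linarith [Real.sqrt_nonneg (4 * Real.log T +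
    logDet lam (fun s => M.featureVec l (R.a s ω)) t)]) hβ
  have hnoise : 1 + √(invForm (R.V lam l t ω)
      (∑ s ∈ Finset.range t, R.η s l ω • M.featureVec l (R.a s ω))) ≤ β :=
    le_trans (add_le_add_right (Real.sqrt_le_sqrt (not_lt.1 hω)) _) hβ
  have hdev' : |y - μ| ≤ √q * β := hdev.trans (mul_le_mul_of_nonneg_left hnoise hq)
  rw [abs_le] at hdev' hr
  refine ⟨?_, ?_⟩
  · exact le_max_of_le_right (le_min hr.2 (by linarith))
  -- For `q ≤ 1` the deviation bound applies; for `q ≥ 1` both quantities lie in `[-1, 1]`, and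
  -- their difference is at most `2 ≤ 2 * β`.
  · rcases le_total q 1 with h1 | h1
    · rw [min_eq_right h1]
      have : max (-1) (min 1 (y + β * √q)) ≤ μ + 2 * β * √q :=
        max_le (by nlinarith [mul_nonneg (by linarith : 0 ≤ β) hq])
          ((min_le_right _ _).trans (by linarith))
      linarith
    · rw [min_eq_left h1, Real.sqrt_one]
      have : max (-1) (min 1 (y + β * √q)) ≤ 1 := max_le (by norm_num) (min_le_left _ _)
      linarith

/-- Exploration costs of a position are bounded on every outcome. -/
lemma RankTSRun.sum_sqrt_min_le (hlam : 0 < lam) (l : Fin L) (ω : Ω) :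
    ∑ t ∈ Finset.range T, √(min 1 (invForm (R.V lam l t ω) (M.featureVec l (R.a t ω)))) ≤
      √(T * (2 * logDet lam (fun s => M.featureVec l (R.a s ω)) T)) := by
  refine Real.le_sqrt_of_sq_le ?_
  refine (sq_sum_le_card_mul_sum_sq (s := Finset.range T)).trans ?_
  rw [Finset.card_range]
  refine mul_le_mul_of_nonneg_left ?_ (Nat.cast_nonneg _)
  refine le_trans (Finset.sum_le_sum fun t _ => ?_)
    (sum_min_one_invForm_le (x := fun s => M.featureVec l (R.a s ω)) hlam T)
  exact (Real.sq_sqrt (le_min zero_le_one (invForm_nonneg (gram_posDef hlam t) _))).le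

lemma RankTSRun.logDet_le_logTerm (hlam : 0 < lam) (hm₁ : 0 < m₁) (hv : ∀ i, ‖M.v i‖ ≤ m₁)
    (hv₀ : (∀ l : Fin L, l.val = 0 → M.w l = 0) ∨ ‖M.v₀‖ ≤ m₁) (l : Fin L) (ω : Ω) :
    logDet lam (fun s => M.featureVec l (R.a s ω)) T ≤ d * M.logTerm T m₁ lam := by
  have h := logDet_le (x := fun s => M.featureVec l (R.a s ω)) (t := T) hlam
    (b := ((1 + ⨆ l, |M.w l|) * m₁) ^ 2) fun s _ => by
      rw [Model.featureVec, ← inner_eq_dotProduct, real_inner_self_eq_norm_sq]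
      gcongr
      exact M.norm_actionFeature_le hm₁ hv hv₀ _ l
  rwa [Fintype.card_fin] at h

end Regret

/-! ### Regret of one position. -/

section RegretBound

variable {Ω : Type*} [MeasurableSpace Ω] {P : Measure Ω} [IsProbabilityMeasure P]

/-- Since `1 + s E X ≤ E exp (s X) ≤ exp (s² / 2)`, the function `exp (s² / 2) - s E X` is minimal
at `s = 0`, where its derivative is `-E X`. -/
lemma integral_eq_zero_of_hasSubgaussianMGF {X : Ω → ℝ} (h : HasSubgaussianMGF X 1 P) :
    ∫ ω, X ω ∂P = 0 := by
  have hle : ∀ s : ℝ, 1 + s * ∫ ω, X ω ∂P ≤ Real.exp (s ^ 2 / 2) := by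
    intro s
    have h1 := h.mgf_le s
    rw [NNReal.coe_one, one_mul] at h1
    refine le_trans ?_ h1
    have hint : Integrable (fun ω => 1 + s * X ω) P :=
      (integrable_const _).add (h.integrable.const_mul s)
    calc 1 + s * ∫ ω, X ω ∂P = ∫ ω, (1 + s * X ω) ∂P := by
          rw [integral_add (integrable_const _) (h.integrable.const_mul s), integral_const_mul]
          simp
      _ ≤ _ := integral_mono hint (h.integrable_exp_mul s) fun ω => by
          have := Real.add_one_le_exp (s * X ω)
          simp only
          linarith
  have hmin : IsLocalMin (fun s : ℝ => Real.exp (s ^ 2 / 2) - s * ∫ ω, X ω ∂P) 0 :=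
    Filter.Eventually.of_forall fun s => by
      have := hle s
      simp only [ne_eq, OfNat.ofNat_ne_zero, not_false_eq_true, zero_pow, zero_div, Real.exp_zero,
        zero_mul, sub_zero]
      linarith
  have hd : HasDerivAt (fun s : ℝ => Real.exp (s ^ 2 / 2) - s * ∫ ω, X ω ∂P)
      (Real.exp ((0 : ℝ) ^ 2 / 2) * ((2 : ℕ) * (0 : ℝ) ^ (2 - 1) / 2) - 1 * ∫ ω, X ω ∂P) 0 :=
    (((hasDerivAt_pow 2 (0 : ℝ)).div_const 2).exp).sub ((hasDerivAt_id (0 : ℝ)).mul_const _)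
  simpa using hmin.hasDerivAt_eq_zero hd

variable {d L K : ℕ} {M : Model d L K}
  {Q : Fin L → Measure (EuclideanSpace ℝ (Fin d))} {T : ℕ} (R : RankTSRun M Q T P)

/-- The loss of position `l` in round `t` against the optimal list. -/
def RankTSRun.gap (l : Fin L) (t : ℕ) (ω : Ω) : ℝ :=
  inner ℝ (R.θ ω l) (M.actionFeature (R.best (R.θ ω)) l) -
    inner ℝ (R.θ ω l) (M.actionFeature (R.a t ω) l)

lemma RankTSRun.regretSample_eq (ω : Ω) :
    R.regretSample ω = ∑ l, ∑ t ∈ Finset.range T, (R.gap l t ω - R.η t l ω) := by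
  conv_rhs => rw [Finset.sum_comm]
  rw [RankTSRun.regretSample, ← Finset.sum_sub_distrib]
  refine Finset.sum_congr rfl fun t ht => ?_
  rw [R.iSup_meanReward, Model.meanReward, ← Finset.sum_sub_distrib]
  refine Finset.sum_congr rfl fun l _ => ?_
  rw [R.reward_eq t (Finset.mem_range.1 ht), RankTSRun.gap]
  ring

lemma RankTSRun.measurable_gap (l : Fin L) {t : ℕ} (ht : t < T) : Measurable (R.gap l t) :=
  ((R.measurable_θ_apply l).inner ((M.measurable_actionFeature l).comp
    (R.measurable_best.comp R.measurable_θ))).sub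
    ((R.measurable_θ_apply l).inner ((M.measurable_actionFeature l).comp (R.measurable_a ht)))

lemma RankTSRun.integrable_ucb (lam β : ℝ) (l : Fin L) {t : ℕ} (ht : t < T)
    {a : Ω → Action L K} (ha : Measurable a) :
    Integrable (fun ω => M.ucb lam β l t (R.H t ω, a ω)) P :=
  Integrable.of_bound ((M.measurable_ucb lam β l t).comp
    ((R.measurable_H ht.le).prodMk ha)).aestronglyMeasurable 1
    (Filter.Eventually.of_forall fun _ => M.abs_ucb_le lam β l t _)

variable [∀ l, IsProbabilityMeasure (Q l)]

lemma RankTSRun.ae_abs_gap_le (hreward : ∀ u : Node L K, ∀ᵐ ϑ ∂(Q u.layer),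
      |inner ℝ ϑ (M.feature u.layer u.prev u.cur)| ≤ 1) :
    ∀ᵐ ω ∂P, ∀ l t, |R.gap l t ω| ≤ 2 := by
  filter_upwards [R.ae_abs_inner_le hreward] with ω hω l t
  have h1 := abs_le.1 (hω l (R.best (R.θ ω)))
  have h2 := abs_le.1 (hω l (R.a t ω))
  rw [RankTSRun.gap, abs_le]
  constructor <;> linarith [h1.1, h1.2, h2.1, h2.2]

lemma RankTSRun.integrable_gap (hreward : ∀ u : Node L K, ∀ᵐ ϑ ∂(Q u.layer),
      |inner ℝ ϑ (M.feature u.layer u.prev u.cur)| ≤ 1) (l : Fin L) {t : ℕ} (ht : t < T) :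
    Integrable (R.gap l t) P := by
  refine Integrable.of_bound (R.measurable_gap l ht).aestronglyMeasurable 2 ?_
  filter_upwards [R.ae_abs_gap_le hreward] with ω hω
  exact hω l t

/-- The index of the optimal list and that of the list played have the same mean. -/
lemma RankTSRun.integral_ucb_best_eq (lam β : ℝ) (l : Fin L) {t : ℕ} (ht : t < T) :
    ∫ ω, M.ucb lam β l t (R.H t ω, R.best (R.θ ω)) ∂P =
      ∫ ω, M.ucb lam β l t (R.H t ω, R.a t ω) ∂P := by
  -- Both integrands are this one function, evaluated at `(H, θ)` and at `(H, θhat)`.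
  have hF : Measurable fun q : (Fin t → Action L K × (Fin L → ℝ)) × Params d L =>
      M.ucb lam β l t (q.1, R.best q.2) := (M.measurable_ucb lam β l t).comp
    (measurable_fst.prodMk (R.measurable_best.comp measurable_snd))
  have h1 := integral_map (μ := P) ((R.measurable_H ht.le).prodMk R.measurable_θ).aemeasurable
    hF.aestronglyMeasurable
  have h2 := integral_map (μ := P)
    ((R.measurable_H ht.le).prodMk (R.measurable_θhat t ht)).aemeasurable hF.aestronglyMeasurable
  rw [R.map_H_θ_eq_map_H_θhat ht, h2] at h1
  rw [← h1, R.a_eq ht]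

variable {m₁ m₂ lam : ℝ}

lemma RankTSRun.integral_sum_gap_le (hm₁ : 0 < m₁) (hm₂ : 0 < m₂) (hlam : lam = 1 / m₂ ^ 2)
    (hv : ∀ i, ‖M.v i‖ ≤ m₁)
    (hv₀ : (∀ l : Fin L, l.val = 0 → M.w l = 0) ∨ ‖M.v₀‖ ≤ m₁)
    (hQ : ∀ l, ∀ᵐ ϑ ∂(Q l), ‖ϑ‖ ≤ m₂)
    (hreward : ∀ u : Node L K, ∀ᵐ ϑ ∂(Q u.layer),
      |inner ℝ ϑ (M.feature u.layer u.prev u.cur)| ≤ 1) (l : Fin L) :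
    ∫ ω, ∑ t ∈ Finset.range T, R.gap l t ω ∂P ≤
      2 * (1 + √(2 * T * d * M.beta T m₁ lam ^ 2 * M.logTerm T m₁ lam)) := by
  have hlam0 : 0 < lam := by rw [hlam]; positivity
  set β := M.beta T m₁ lam with hβ
  set D := d * M.logTerm T m₁ lam with hD
  have hβ1 : 1 ≤ β := by
    rw [hβ, Model.beta]
    linarith [Real.sqrt_nonneg (4 * Real.log T + d * M.logTerm T m₁ lam)]
  have hlog : ∀ ω, logDet lam (fun s => M.featureVec l (R.a s ω)) T ≤ D := fun ω =>
    R.logDet_le_logTerm hlam0 hm₁ hv hv₀ l ω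
  have hrhs : √(2 * T * d * β ^ 2 * M.logTerm T m₁ lam) = β * √(T * (2 * D)) := by
    rw [← Real.sqrt_sq (by linarith : 0 ≤ β), ← Real.sqrt_mul (sq_nonneg β),
      Real.sqrt_sq (by linarith : 0 ≤ β)]
    congr 1
    rw [hD]
    ring
  rw [hrhs]
  have hsq : 0 ≤ β * √(T * (2 * D)) := mul_nonneg (by linarith) (Real.sqrt_nonneg _)
  rcases Nat.lt_or_ge T 2 with hT | hT
  -- At most one round, which costs at most `2`; the failure cost `4 / T` is below `2` only from `T
  -- = 2` on.
  · calc ∫ ω, ∑ t ∈ Finset.range T, R.gap l t ω ∂P ≤ ∫ _, (2 : ℝ) ∂P := by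
          refine integral_mono_ae (integrable_finsetSum _ fun t ht =>
            R.integrable_gap hreward l (Finset.mem_range.1 ht)) (integrable_const _) ?_
          filter_upwards [R.ae_abs_gap_le hreward] with ω hω
          interval_cases T
          · simp
          · simpa using (abs_le.1 (hω l 0)).2
      _ = 2 := by simp
      _ ≤ _ := by linarith
  · let I : ℕ → Ω → ℝ := fun t ω => M.ucb lam β l t (R.H t ω, R.best (R.θ ω)) -
      M.ucb lam β l t (R.H t ω, R.a t ω)
    let B : ℕ → Ω → ℝ := fun t => (R.badEvent lam l t).indicator 1
    have hI1 : ∀ t < T, Integrable (fun ω => M.ucb lam β l t (R.H t ω, R.best (R.θ ω))) P :=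
      fun t ht => R.integrable_ucb lam β l ht (R.measurable_best.comp R.measurable_θ)
    have hI2 : ∀ t < T, Integrable (fun ω => M.ucb lam β l t (R.H t ω, R.a t ω)) P :=
      fun t ht => R.integrable_ucb lam β l ht (R.measurable_a ht)
    have hI : ∀ t < T, Integrable (I t) P := fun t ht => (hI1 t ht).sub (hI2 t ht)
    have hI0 : ∀ t < T, ∫ ω, I t ω ∂P = 0 := fun t ht => by
      rw [integral_sub (hI1 t ht) (hI2 t ht), R.integral_ucb_best_eq lam β l ht, sub_self]
    have hBm : ∀ t < T, MeasurableSet (R.badEvent lam l t) := fun t ht =>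
      R.measurableSet_badEvent lam l ht.le
    have hB : ∀ t < T, Integrable (B t) P := fun t ht =>
      IntegrableOn.integrable_indicator (integrable_const (1 : ℝ)).integrableOn (hBm t ht)
    have hB0 : ∀ t < T, ∫ ω, B t ω ∂P ≤ 1 / (T : ℝ) ^ 2 := fun t ht => by
      rw [integral_indicator_one (hBm t ht)]
      exact R.measureReal_badEvent_le hlam0 l ht
    have hpoint : ∀ᵐ ω ∂P, ∀ t < T, R.gap l t ω ≤ I t ω + 4 * B t ω +
        2 * β * √(min 1 (invForm (R.V lam l t ω) (M.featureVec l (R.a t ω)))) := by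
      filter_upwards [R.ae_norm_θ_le hQ, R.ae_abs_inner_le hreward] with ω hθ hr t ht
      have hb0 : 0 ≤ 2 * β * √(min 1 (invForm (R.V lam l t ω) (M.featureVec l (R.a t ω)))) :=
        mul_nonneg (by linarith) (Real.sqrt_nonneg _)
      -- On the bad event the loss is at most `2` and the difference `I` of two indices is at least
      -- `-2`, whence the factor `4`.
      by_cases hω : ω ∈ R.badEvent lam l t
      · have h1 := abs_le.1 (M.abs_ucb_le lam β l t (R.H t ω, R.best (R.θ ω)))
        have h2 := abs_le.1 (M.abs_ucb_le lam β l t (R.H t ω, R.a t ω))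
        have h3 := abs_le.1 (hr l (R.best (R.θ ω)))
        have h4 := abs_le.1 (hr l (R.a t ω))
        simp only [B, I, Set.indicator_of_mem hω, Pi.one_apply, RankTSRun.gap]
        linarith [h1.1, h1.2, h2.1, h2.2, h3.1, h3.2, h4.1, h4.2]
      · have hβt : 1 + √(4 * Real.log T + logDet lam (fun s => M.featureVec l (R.a s ω)) t) ≤
            β := by
          rw [hβ, Model.beta]
          gcongr
          exact (logDet_mono hlam0 ht.le).trans (hlog ω)
        -- Optimism is used at the optimal list, the width bound at the played list.
        have h1 := (R.ucb_bounds hm₂ hlam l ht.le hω hβt (hθ l) (R.best (R.θ ω)) (hr l _)).1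
        have h2 := (R.ucb_bounds hm₂ hlam l ht.le hω hβt (hθ l) (R.a t ω) (hr l _)).2
        simp only [B, I, Set.indicator_of_notMem hω, RankTSRun.gap]
        linarith
    have hT0 : (0 : ℝ) < T := by positivity
    have hIB : ∀ t ∈ Finset.range T, Integrable (fun ω => I t ω + 4 * B t ω) P := fun t ht =>
      (hI t (Finset.mem_range.1 ht)).add ((hB t (Finset.mem_range.1 ht)).const_mul 4)
    calc ∫ ω, ∑ t ∈ Finset.range T, R.gap l t ω ∂P
        ≤ ∫ ω, (∑ t ∈ Finset.range T, (I t ω + 4 * B t ω) + 2 * β * √(T * (2 * D))) ∂P := by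
          refine integral_mono_ae (integrable_finsetSum _ fun t ht =>
            R.integrable_gap hreward l (Finset.mem_range.1 ht))
            ((integrable_finsetSum _ hIB).add (integrable_const _)) ?_
          filter_upwards [hpoint] with ω hω
          have h1 := Finset.sum_le_sum fun t (ht : t ∈ Finset.range T) =>
            hω t (Finset.mem_range.1 ht)
          rw [Finset.sum_add_distrib, ← Finset.mul_sum] at h1
          refine h1.trans (add_le_add_right (mul_le_mul_of_nonneg_left ?_ (by linarith)) _)
          refine (R.sum_sqrt_min_le hlam0 l ω).trans (Real.sqrt_le_sqrt ?_)
          have := hlog ω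
          gcongr
      _ = ∑ t ∈ Finset.range T, (∫ ω, I t ω ∂P + 4 * ∫ ω, B t ω ∂P) + 2 * β * √(T * (2 * D)) := by
          rw [integral_add (integrable_finsetSum _ hIB) (integrable_const _),
            integral_finsetSum _ hIB]
          simp only [integral_const, probReal_univ, one_smul]
          congr 1
          refine Finset.sum_congr rfl fun t ht => ?_
          rw [integral_add (hI t (Finset.mem_range.1 ht))
            ((hB t (Finset.mem_range.1 ht)).const_mul 4), integral_const_mul]
      _ ≤ ∑ t ∈ Finset.range T, 4 * (1 / (T : ℝ) ^ 2) + 2 * β * √(T * (2 * D)) := by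
          gcongr with t ht
          rw [hI0 t (Finset.mem_range.1 ht), zero_add]
          exact mul_le_mul_of_nonneg_left (hB0 t (Finset.mem_range.1 ht)) (by norm_num)
      _ ≤ 2 + 2 * β * √(T * (2 * D)) := by
          gcongr
          rw [Finset.sum_const, Finset.card_range, nsmul_eq_mul]
          have : (2 : ℝ) ≤ T := by exact_mod_cast hT
          have h4 : (T : ℝ) * (4 * (1 / (T : ℝ) ^ 2)) = 4 / T := by field_simp
          rw [h4, div_le_iff₀ hT0]
          linarith
      _ = _ := by ring

end RegretBound

end RankBandit

end

/-! ### Summation over positions, with the centered noise removed. -/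

theorem theorem3 {Ω : Type*} [MeasurableSpace Ω] (P : MeasureTheory.Measure Ω)
    [MeasureTheory.IsProbabilityMeasure P] {d L K : ℕ} (M : RankBandit.Model d L K)
    (Q : Fin L → MeasureTheory.Measure (EuclideanSpace ℝ (Fin d)))
    [∀ l, MeasureTheory.IsProbabilityMeasure (Q l)] (T : ℕ)
    (R : RankBandit.RankTSRun M Q T P)
    (m₁ m₂ lam : ℝ) (hm₁ : 0 < m₁) (hm₂ : 0 < m₂) (hlam : lam = 1 / m₂ ^ 2)
    (hv : ∀ i, ‖M.v i‖ ≤ m₁)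
    (hv₀ : (∀ l : Fin L, l.val = 0 → M.w l = 0) ∨ ‖M.v₀‖ ≤ m₁)
    (hQ : ∀ l, ∀ᵐ ϑ ∂(Q l), ‖ϑ‖ ≤ m₂)
    (hreward : ∀ u : RankBandit.Node L K, ∀ᵐ ϑ ∂(Q u.layer),
      |inner ℝ ϑ (M.feature u.layer u.prev u.cur)| ≤ 1) :
    MeasureTheory.Integrable R.regretSample P ∧
      ∫ ω, R.regretSample ω ∂P ≤
        2 * L * (1 + √(2 * T * d * M.beta T m₁ lam ^ 2 * M.logTerm T m₁ lam)) := by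
  have hint : ∀ l, ∀ t ∈ Finset.range T,
      MeasureTheory.Integrable (fun ω => R.gap l t ω - R.η t l ω) P := fun l t ht =>
    (R.integrable_gap hreward l (Finset.mem_range.1 ht)).sub
      (R.noise_subgaussian t (Finset.mem_range.1 ht) l).integrable
  have heq : R.regretSample = fun ω => ∑ l, ∑ t ∈ Finset.range T, (R.gap l t ω - R.η t l ω) :=
    funext R.regretSample_eq
  have hint' : ∀ l ∈ (Finset.univ : Finset (Fin L)), MeasureTheory.Integrable
      (fun ω => ∑ t ∈ Finset.range T, (R.gap l t ω - R.η t l ω)) P := fun l _ =>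
    MeasureTheory.integrable_finsetSum _ (hint l)
  rw [heq]
  refine ⟨MeasureTheory.integrable_finsetSum _ hint', ?_⟩
  rw [MeasureTheory.integral_finsetSum _ hint']
  calc _ ≤ ∑ _l : Fin L,
        2 * (1 + √(2 * T * d * M.beta T m₁ lam ^ 2 * M.logTerm T m₁ lam)) := by
        refine Finset.sum_le_sum fun l _ => ?_
        refine le_of_eq_of_le ?_ (R.integral_sum_gap_le hm₁ hm₂ hlam hv hv₀ hQ hreward l)
        rw [MeasureTheory.integral_finsetSum _ (hint l), MeasureTheory.integral_finsetSum _
          fun t ht => R.integrable_gap hreward l (Finset.mem_range.1 ht)]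
        refine Finset.sum_congr rfl fun t ht => ?_
        have ht' := Finset.mem_range.1 ht
        rw [MeasureTheory.integral_sub (R.integrable_gap hreward l ht')
          (R.noise_subgaussian t ht' l).integrable,
          RankBandit.integral_eq_zero_of_hasSubgaussianMGF (R.noise_subgaussian t ht' l), sub_zero]
    _ = _ := by
        rw [Finset.sum_const, Finset.card_univ, Fintype.card_fin, nsmul_eq_mul]
        ring
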